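/- **Conventions.** Binary trees are rooted ordered trees in which every node has a possibly empty left and a possibly empty right subtree; $|t|$ is the number of nodes of $t$, $t[v]$ the subtree of $t$ formed by $v$ and its descendants, and $\lg=\log_2$. $BP$ is the balanced-parenthesis encoding ($BP(t)$ is empty for the empty tree and $\texttt{(}\,BP(t_\ell)\,\texttt{)}\,BP(t_r)$ otherwise), and $\gamma$ is the Elias gamma code. **Type processes.** The type of a node is $0$ if it is a leaf, $1$ if it has only a left child, $2$ if it has two children, $3$ if it has only a right child. The $k$-history $h_k(v)\in\{1,2,3\}^k$ is the length-$k$ suffix of $1^k h(v)$, where $h(v)$ is the word of the types of the proper ancestors of $v$, from the root down. A $k$th-order type process $\tau=(\tau_z)_{z\in\{1,2,3\}^k}$ consists of probability distributions $\tau_z$ on $\{0,1,2,3\}$, and $\mathbb P[t]=\prod_{v\in t}\tau_{h_k(v)}(\mathrm{type}(v))$. With $n_z^t$ (resp. $n_{z,i}^t$) the number of nodes of $t$ with $k$-history $z$ (resp. with $k$-history $z$ and type $i$), the $k$th-order empirical type entropy is $H_k^{\mathrm{type}}(t)=\sum_{z\in\{1,2,3\}^k}\sum_{i=0}^{3} n_{z,i}^t\lg\bigl(n_z^t/n_{z,i}^t\bigr)$,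 where terms with $n_{z,i}^t=0$ are $0$. **Hypersuccinct code.** Let $t$ be a binary tree with $n$ nodes, $B=\lceil\frac18\lg n\rceil$ and $\mu=\lceil\frac14\lg n\rceil$. The nodes of $t$ are partitioned into micro trees $\mu_1,\dots,\mu_m$ by the Farzan–Munro algorithm, bottom-up: call $v$ heavy if $|t[v]|\ge B$. If both children of $v$ are heavy, $\{v\}$ and the active components of both children are declared permanent. Otherwise $v$ is merged with the non-permanent active components of its children, and the resulting active component is declared permanent as soon as it has at least $B$ nodes. The top tier $\Upsilon$ is the binary tree with $m$ nodes obtained by contracting each micro tree; the null pointers of a micro tree at which child micro trees are attached are its portals. Let $C$ be a Huffman code (the output of any run of Huffman's algorithm) for the sequence of the shapes of $\mu_1,\dots,\mu_m$, and let $\bar C(s)=\texttt{0}\,\gamma(|s|+1)\,BP(s)$ if $|C(s)|>2|s|+2\lfloor\lg(|s|+1)\rfloor$ and $\bar C(s)=\texttt{1}\,C(s)$ otherwise. Then $\mathsf H(t)$ is the concatenation of (1) $\gamma(n)\gamma(m)$; (2) $BP(\Upsilon)$; (3) a table of the codewords $\bar C(s)$ for the distinct micro-tree shapes $s$, each followed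 by $\gamma(|s|)\,BP(s)$ (the table is preceded by its number of entries and each codeword by its length, in gamma code); (4) the codewords $\bar C(\mu_i)$ in depth-first order of $\Upsilon$; (5) in the same order, for each micro tree two $\lceil\lg(\mu+1)\rceil$-bit integers, the ranks of its portals to its left and to its right child micro tree among its null pointers, counted from left to right ($0$ if there is no such portal). **Theorem.** There is an absolute constant $c$ such that for every $k\ge 0$, every $n\ge 3$ and every binary tree $t$ with $n$ nodes, and however ties are broken in the Huffman algorithm, the following hold. 1. For every $k$th-order type process $\tau$ with $\mathbb P[t]>0$, $$|\mathsf H(t)|\le\lg\frac1{\mathbb P[t]}+c\cdot\frac{nk+n\lg\lg n}{\lg n}.$$ 2. In particular (taking for $\tau$ the empirical type process of $t$), $$|\mathsf H(t)|\le H_k^{\mathrm{type}}(t)+c\cdot\frac{nk+n\lg\lg n}{\lg n}.$$ -/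

import Mathlib

namespace Hypersuccinct

/-! ### Binary trees and elementary codes

`BinaryTree Unit` is the set of binary trees in which every node has a possibly empty left
and a possibly empty right subtree; `nil` is the empty tree. Bit strings are `List Bool`. -/

/-- Shapes of binary trees, the empty tree included. -/
abbrev Shape := BinaryTree Unit

/-- Is the tree nonempty? -/
def isNode {α : Type*} : BinaryTree α → Bool
  | .nil => false
  | .node _ _ _ => true

/-- The labels of a tree, listed in depth-first (preorder) order. -/
def preorder {α : Type*} : BinaryTree α → List α
  | .nil => []
  | .node a l r => a :: (preorder l ++ preorder r)

/-- The balanced-parenthesis string: `true` opens, `false` closes a parenthesis. -/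
def bp {α : Type*} : BinaryTree α → List Bool
  | .nil => []
  | .node _ l r => true :: (bp l ++ false :: bp r)

/-- Elias gamma code of `n ≥ 1`: the binary representation of `n` (most significant bit first),
preceded by `⌊lg n⌋` zeros. -/
def gamma (n : ℕ) : List Bool :=
  List.replicate (Nat.log 2 n) false ++ n.bits.reverse

/-- The number `x` written with exactly `w` bits, most significant bit first. -/
def fixedWidth (w x : ℕ) : List Bool :=
  List.ofFn fun i : Fin w => x.testBit (w - 1 - i)

/-! ### Huffman codes -/

/-- Code trees whose leaves carry the letters of an alphabet. -/
inductive CodeTree (α : Type*) where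
  | leaf (a : α) : CodeTree α
  | branch (l r : CodeTree α) : CodeTree α

/-- The letters at the leaves of a code tree. -/
def CodeTree.letters {α : Type*} : CodeTree α → List α
  | .leaf a => [a]
  | .branch l r => l.letters ++ r.letters

/-- The total weight of the letters of a code tree. -/
def CodeTree.weight {α : Type*} (w : α → ℕ) (T : CodeTree α) : ℕ :=
  (T.letters.map w).sum

/-- The codeword of a letter: the path from the root to its leaf (`false` is left). -/
def CodeTree.codeword {α : Type*} [DecidableEq α] : CodeTree α → α → List Bool
  | .leaf _, _ => []
  | .branch l r, a =>
      if a ∈ l.letters then false :: l.codeword a else true :: r.codeword a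

/-- One step of Huffman's algorithm: two trees of the forest, no heavier than all the others,
are joined under a new root. Ties may be broken arbitrarily. -/
def HuffmanStep {α : Type*} (w : α → ℕ) (F G : Multiset (CodeTree α)) : Prop :=
  ∃ (S T : CodeTree α) (R : Multiset (CodeTree α)),
    F = S ::ₘ T ::ₘ R ∧ (∀ X ∈ R, S.weight w ≤ X.weight w ∧ T.weight w ≤ X.weight w) ∧
      G = CodeTree.branch S T ::ₘ R

/-- `C` is a Huffman code for the string `s`: it is read off from the final tree of some run of
Huffman's algorithm, started with one leaf for each letter that occurs in `s`, weighted by its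
number of occurrences. (The final forest has no tree only if `s` is the empty string.) -/
def IsHuffmanCode {α : Type*} [DecidableEq α] (s : List α) (C : α → List Bool) : Prop :=
  ∃ F : Multiset (CodeTree α),
    Relation.ReflTransGen (HuffmanStep fun a => s.count a)
      (s.toFinset.val.map CodeTree.leaf) F ∧
    F.card ≤ 1 ∧ ∀ T ∈ F, ∀ a ∈ s, C a = T.codeword a

/-- Huffman's algorithm never gets stuck: every forest can be reduced to at most one tree. -/
theorem exists_huffman_run {α : Type*} (w : α → ℕ) (F : Multiset (CodeTree α)) :
    ∃ G, Relation.ReflTransGen (HuffmanStep w) F G ∧ G.card ≤ 1 := by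
  induction hn : F.card generalizing F with
  | zero => exact ⟨F, .refl, by omega⟩
  | succ n ih =>
    have hmin : ∀ F : Multiset (CodeTree α), F ≠ 0 →
        ∃ S R, F = S ::ₘ R ∧ ∀ X ∈ R, S.weight w ≤ X.weight w := by
      intro F hF
      obtain ⟨S, hS, hle⟩ := Multiset.exists_min_image (CodeTree.weight w) hF
      obtain ⟨R, rfl⟩ := Multiset.exists_cons_of_mem hS
      exact ⟨S, R, rfl, fun X hX => hle X (Multiset.mem_cons_of_mem hX)⟩
    obtain ⟨S, R, rfl, hS⟩ := hmin F (by rintro rfl; simp at hn)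
    by_cases hR : R = 0
    · exact ⟨_, .refl, by simp [hR]⟩
    obtain ⟨T, Q, rfl, hT⟩ := hmin R hR
    obtain ⟨G, hG, hc⟩ := ih (CodeTree.branch S T ::ₘ Q) (by simpa using hn)
    exact ⟨G, .head ⟨S, T, Q, rfl,
      fun X hX => ⟨hS X (Multiset.mem_cons_of_mem hX), hT X hX⟩, rfl⟩ hG, hc⟩

/-- Every string has a Huffman code. -/
theorem exists_isHuffmanCode {α : Type*} [DecidableEq α] (s : List α) :
    ∃ C, IsHuffmanCode s C := by
  obtain ⟨G, hG, hc⟩ := exists_huffman_run (fun a => s.count a)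
    (s.toFinset.val.map CodeTree.leaf)
  rcases Nat.le_one_iff_eq_zero_or_eq_one.1 hc with h | h
  · rw [Multiset.card_eq_zero] at h
    exact ⟨fun _ => [], G, hG, hc, by simp [h]⟩
  · obtain ⟨T, rfl⟩ := Multiset.card_eq_one.1 h
    exact ⟨T.codeword, {T}, hG, hc, by simp⟩

/-! ### Tree covering -/

/-- Outcome of the tree-covering procedure on a subtree `t[v]`.
* `cuts`: the tree `t[v]`, each node labelled with two bits that tell whether the edge to its
  left child, respectively to its right child, connects two different micro trees;
* `size`: the number of nodes of the active component, the one that contains `v`;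
* `permanent`: whether the active component has been declared permanent. -/
structure Covering where
  cuts : BinaryTree (Bool × Bool)
  size : ℕ
  permanent : Bool

/-- A node `v` is heavy if `|t[v]| ≥ B`; a missing child is not a heavy node. -/
def IsHeavy (B : ℕ) (t : Shape) : Prop := t ≠ .nil ∧ B ≤ t.numNodes

instance (B : ℕ) (t : Shape) : Decidable (IsHeavy B t) :=
  inferInstanceAs (Decidable (_ ∧ _))

/-- The Farzan–Munro algorithm with parameter `B` on binary trees, bottom-up.
If both children of `v` are heavy, then `{v}` and the active components of both children become
permanent. Otherwise `v` is put together with those active components of its children that are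
not permanent, and the new component becomes permanent once it has at least `B` nodes. -/
def farzanMunro (B : ℕ) : Shape → Covering
  | .nil => ⟨.nil, 0, false⟩
  | .node _ l r =>
    let L := farzanMunro B l
    let R := farzanMunro B r
    if IsHeavy B l ∧ IsHeavy B r then
      ⟨.node (true, true) L.cuts R.cuts, 1, true⟩
    else
      let s := 1 + (if L.permanent then 0 else L.size) + (if R.permanent then 0 else R.size)
      ⟨.node (L.permanent, R.permanent) L.cuts R.cuts, s, decide (B ≤ s)⟩

/-- A micro tree: its local shape, and the ranks of its portals (to its left, respectively right
child micro tree) among the null pointers of the shape, counted from `0` from left to right;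
a rank is `0` if there is no such portal. -/
structure MicroTree where
  shape : Shape
  leftPortal : ℕ
  rightPortal : ℕ

/-- The local shape of the component that contains the root. -/
def localShape : BinaryTree (Bool × Bool) → Shape
  | .nil => .nil
  | .node c l r =>
      .node () (if c.1 then .nil else localShape l) (if c.2 then .nil else localShape r)

/-- The rank of the portal in a list of null pointers, shifted by `offset`. -/
def portalRank (offset : ℕ) (ps : List (BinaryTree MicroTree)) : ℕ :=
  ((ps.findIdx? isNode).map (offset + ·)).getD 0

/-- The nonempty tree in a list of null pointers, if there is one. -/
def portalTarget (ps : List (BinaryTree MicroTree)) : BinaryTree MicroTree :=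
  (ps.find? isNode).getD .nil

/-- Contraction of the components. The first entry is the top tier of the given tree. The second
entry lists the null pointers of the local shape of the component containing the root, from left
to right; each one is represented by the top tier of the subtree that is attached there
(`nil` if the null pointer is not a portal). The left (right) child of a micro tree in the top
tier is the micro tree attached in the left (right) subtree of its root. -/
def contract : BinaryTree (Bool × Bool) → BinaryTree MicroTree × List (BinaryTree MicroTree)
  | .nil => (.nil, [.nil])
  | .node c l r =>
    let ps := if c.1 then [(contract l).1] else (contract l).2
    let qs := if c.2 then [(contract r).1] else (contract r).2
    (.node ⟨localShape (.node c l r), portalRank 0 ps, portalRank ps.length qs⟩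
        (portalTarget ps) (portalTarget qs),
      ps ++ qs)

/-- The top tier of `t`, each node labelled with the micro tree that was contracted into it. -/
def topTier (B : ℕ) (t : Shape) : BinaryTree MicroTree :=
  (contract (farzanMunro B t).cuts).1

/-! ### The hypersuccinct code -/

/-- The length-restricted version of a code for binary trees. -/
def restrict (C : Shape → List Bool) (s : Shape) : List Bool :=
  if 2 * s.numNodes + 2 * Nat.log 2 (s.numNodes + 1) < (C s).length then
    false :: (gamma (s.numNodes + 1) ++ bp s)
  else
    true :: C s

/-- The five parts of the encoding of a tree with `n` nodes and top tier `U`, where `C` is the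
code used for the shapes of the micro trees and portals are stored with `w` bits each.
The table in the third part is preceded by its number of entries, and each codeword in it by its
length, so that the table can be parsed. -/
def encode (w n : ℕ) (U : BinaryTree MicroTree) (C : Shape → List Bool) : List Bool :=
  let shapes := (preorder U).map MicroTree.shape
  let alphabet := shapes.dedup
  (gamma n ++ gamma U.numNodes)
    ++ bp U
    ++ (gamma alphabet.length ++ alphabet.flatMap fun s =>
        gamma (restrict C s).length ++ restrict C s ++ gamma s.numNodes ++ bp s)
    ++ shapes.flatMap (restrict C)
    ++ (preorder U).flatMap fun M => fixedWidth w M.leftPortal ++ fixedWidth w M.rightPortal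

/-- The parameter `B = ⌈(lg n) / 8⌉` of the tree covering. -/
noncomputable def coverParam (n : ℕ) : ℕ := ⌈Real.logb 2 n / 8⌉₊

/-- The bound `μ = ⌈(lg n) / 4⌉` on the size of micro trees. -/
noncomputable def microBound (n : ℕ) : ℕ := ⌈Real.logb 2 n / 4⌉₊

/-- The top tier used for encoding `t`. -/
noncomputable def tier (t : Shape) : BinaryTree MicroTree :=
  topTier (coverParam t.numNodes) t

/-- `H` is a hypersuccinct code for binary trees: each `t` is encoded by means of some Huffman
code for the sequence of the shapes of its micro trees (Huffman codes are unique only up to the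
breaking of ties), and portals are stored with `⌈lg (μ + 1)⌉` bits. -/
def IsHypersuccinctCode (H : Shape → List Bool) : Prop :=
  ∀ t : Shape, ∃ C : Shape → List Bool,
    IsHuffmanCode ((preorder (tier t)).map MicroTree.shape) C ∧
      H t = encode (Nat.clog 2 (microBound t.numNodes + 1)) t.numNodes (tier t) C

/-- A hypersuccinct code exists. -/
theorem exists_isHypersuccinctCode : ∃ H, IsHypersuccinctCode H := by
  choose C hC using fun t : Shape =>
    exists_isHuffmanCode ((preorder (tier t)).map MicroTree.shape)
  exact ⟨_, fun t => ⟨C t, hC t, rfl⟩⟩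

/-! ### Node types, type processes and empirical entropy -/

/-- The type of the root of a tree with subtrees `l` and `r`: `0` for a leaf, `1` for a single
left child, `2` for two children, `3` for a single right child. -/
def nodeType (l r : Shape) : Fin 4 :=
  match isNode l, isNode r with
  | false, false => 0
  | true, false => 1
  | true, true => 2
  | false, true => 3

/-- The types `1, 2, 3` of nodes that have a child. -/
abbrev InnerType := {i : Fin 4 // i ≠ 0}

/-- The pairs `(h(v), type(v))` for all nodes `v` of a subtree whose root has history `h`. -/
def nodesFrom (h : List InnerType) : Shape → List (List InnerType × Fin 4)
  | .nil => []
  | .node _ l r =>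
    (h, nodeType l r) ::
      if ht : nodeType l r ≠ 0 then
        nodesFrom (h ++ [⟨nodeType l r, ht⟩]) l ++ nodesFrom (h ++ [⟨nodeType l r, ht⟩]) r
      else []

/-- The `k`-history: the suffix of length `k` of `1ᵏ h`. -/
def kHistory (k : ℕ) (h : List InnerType) : List.Vector InnerType k :=
  ⟨(List.replicate k (⟨1, by decide⟩ : InnerType) ++ h).drop h.length, by simp⟩

/-- The pairs `(h_k(v), type(v))` for all nodes `v` of `t`. -/
def typedNodes (k : ℕ) (t : Shape) : List (List.Vector InnerType k × Fin 4) :=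
  (nodesFrom [] t).map fun p => (kHistory k p.1, p.2)

/-- A `k`-th order type process: a probability distribution on `{0, 1, 2, 3}` for each
`z ∈ {1, 2, 3}ᵏ`. -/
abbrev TypeProcess (k : ℕ) := List.Vector InnerType k → stdSimplex ℝ (Fin 4)

/-- The probability `ℙ[t]` that a type process assigns to a binary tree. -/
noncomputable def TypeProcess.prob {k : ℕ} (τ : TypeProcess k) (t : Shape) : ℝ :=
  ((typedNodes k t).map fun p => (τ p.1).1 p.2).prod

/-- The number of nodes of `t` with `k`-history `z`. -/
def historyCount {k : ℕ} (t : Shape) (z : List.Vector InnerType k) : ℕ :=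
  ((typedNodes k t).map Prod.fst).count z

/-- The number of nodes of `t` with `k`-history `z` and type `i`. -/
def typeCount {k : ℕ} (t : Shape) (z : List.Vector InnerType k) (i : Fin 4) : ℕ :=
  (typedNodes k t).count (z, i)

/-- The (unnormalized) `k`-th order empirical type entropy of `t`; a summand with
`typeCount t z i = 0` vanishes. -/
noncomputable def typeEntropy (k : ℕ) (t : Shape) : ℝ :=
  ∑ z : List.Vector InnerType k, ∑ i : Fin 4,
    (typeCount t z i : ℝ) * Real.logb 2 (historyCount t z / typeCount t z i)

end Hypersuccinct

/-!
A Huffman code is optimal among all assignments of codeword lengths that satisfy Kraft's inequality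
(`IsHuffmanCode.sum_length_le`). So the codewords of the micro trees take at most
`∑ (lg (1 / q (μᵢ)) + 1)` bits, for every subprobability distribution `q` on nonempty shapes, and
it remains to find a `q` whose product over the micro trees is not much smaller than `ℙ[t]`.

Within a micro tree, histories and types differ from those in `t` for two reasons only: the history
of its root is unknown, and the types of the nodes that own portals are changed by the cuts. The
algorithm of Farzan and Munro puts all portals of a micro tree at one node
(`singlePortalNode_farzanMunro`): a node whose children are not both heavy has a light child, which
lies in the same component without portals, and otherwise the node is a component by itself. Hence
the factors of `ℙ[t]` that belong to a micro tree are reproduced by a process `TypeProcess.modProb`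
that starts with the right history and is modified at one node, where the local type is uniformly
distributed and a prescribed type is used for the histories below; the modification costs a
factor of at most `4` (`TypeProcess.exists_compProb_le_modProb`). For every start
history, index of the modified node in preorder, and prescribed type, this process is a
subprobability distribution on nonempty shapes (`TypeProcess.sum_modProb_le_one`). The distribution
`q` is the average over all these contexts, of which there are `3 ^ k * (4 * (2 * B))`, so that
a micro tree costs `k lg 3 + O(lg lg n)` bits in addition to its share of `lg (1 / ℙ[t])`
(`TypeProcess.prob_le_tierShare`, `TypeProcess.sum_length_huffman_le`).

A potential argument gives at most `4 * n / B = O(n / lg n)` micro trees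
(`mul_numNodes_topTier_le`), so these extra bits, the top tier and the portals fit into the error
term. Micro trees have fewer than `2 * B` nodes, thus at most `4 ^ (2 * B) = O(√n)` shapes
(`card_shapes_le`), and the table has `O(√n * lg n)` bits. The second inequality is the first one
for the empirical process, whose probability for `t` is `2 ^ (-H)`, where `H` is the type entropy
(`logb_prob_empiricalProcess`).
-/

namespace Hypersuccinct

/-! ### Optimality of Huffman codes -/

/-- The sum of the weights of the inner nodes of a code tree, which is the weighted sum of the
depths of its leaves. -/
def CodeTree.cost {α : Type*} (w : α → ℕ) : CodeTree α → ℕ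
  | .leaf _ => 0
  | .branch l r => (CodeTree.branch l r).weight w + l.cost w + r.cost w

theorem CodeTree.weight_branch {α : Type*} (w : α → ℕ) (S T : CodeTree α) :
    (CodeTree.branch S T).weight w = S.weight w + T.weight w := by
  simp [CodeTree.weight, CodeTree.letters]

/-- The letters have to be distinct, since `codeword` descends to the left whenever the letter
occurs there. -/
theorem CodeTree.sum_length_codeword {α : Type*} [DecidableEq α] (w : α → ℕ) (T : CodeTree α)
    (hT : T.letters.Nodup) :
    (T.letters.map fun a => w a * (T.codeword a).length).sum = T.cost w := by
  induction T with
  | leaf a => simp [CodeTree.letters, CodeTree.codeword, CodeTree.cost]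
  | branch l r ihl ihr =>
    rw [CodeTree.letters, List.nodup_append'] at hT
    obtain ⟨hl, hr, hd⟩ := hT
    have e1 : (l.letters.map fun a => w a * ((CodeTree.branch l r).codeword a).length) =
        l.letters.map fun a => w a + w a * (l.codeword a).length := by
      refine List.map_congr_left fun a ha => ?_
      simp [CodeTree.codeword, ha]
      ring
    have e2 : (r.letters.map fun a => w a * ((CodeTree.branch l r).codeword a).length) =
        r.letters.map fun a => w a + w a * (r.codeword a).length := by
      refine List.map_congr_left fun a ha => ?_
      have : a ∉ l.letters := fun h => hd h ha
      simp [CodeTree.codeword, this]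
      ring
    rw [CodeTree.letters, List.map_append, List.sum_append, e1, e2, List.sum_map_add,
      List.sum_map_add, ihl hl, ihr hr, CodeTree.cost, CodeTree.weight_branch,
      CodeTree.weight, CodeTree.weight]
    ring

/-- The Kraft sum of a multiset of items with codeword lengths. -/
noncomputable def kraftSum {ι : Type*} (P : Multiset (ι × ℕ)) : ℝ :=
  (P.map fun p => (1 / 2 : ℝ) ^ p.2).sum

/-- The weighted length of a multiset of items with codeword lengths. -/
def weightedLength {ι : Type*} (w : ι → ℕ) (P : Multiset (ι × ℕ)) : ℕ :=
  (P.map fun p => w p.1 * p.2).sum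

@[simp] theorem kraftSum_cons {ι : Type*} (p : ι × ℕ) (P : Multiset (ι × ℕ)) :
    kraftSum (p ::ₘ P) = (1 / 2 : ℝ) ^ p.2 + kraftSum P := by
  simp [kraftSum]

@[simp] theorem weightedLength_cons {ι : Type*} (w : ι → ℕ) (p : ι × ℕ)
    (P : Multiset (ι × ℕ)) :
    weightedLength w (p ::ₘ P) = w p.1 * p.2 + weightedLength w P := by
  simp [weightedLength]

/-- An item of least weight may be given the longest codeword, by exchanging two lengths. The
longest length `c` obeys every bound `b` on all lengths. -/
theorem exists_swap_longest {ι : Type*} (w : ι → ℕ) (x : ι) (a : ℕ) (Q : Multiset (ι × ℕ))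
    (hw : ∀ p ∈ Q, w x ≤ w p.1) :
    ∃ c Q', Q'.map Prod.fst = Q.map Prod.fst ∧
      kraftSum ((x, c) ::ₘ Q') = kraftSum ((x, a) ::ₘ Q) ∧ (∀ p ∈ Q', p.2 ≤ c) ∧
      (∀ b, a ≤ b → (∀ p ∈ Q, p.2 ≤ b) → c ≤ b) ∧
      weightedLength w ((x, c) ::ₘ Q') ≤ weightedLength w ((x, a) ::ₘ Q) := by
  by_cases h : ∀ p ∈ Q, p.2 ≤ a
  · exact ⟨a, Q, rfl, rfl, h, fun b hab _ => hab, le_rfl⟩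
  push Not at h
  obtain ⟨p₀, hp₀, hlt⟩ := h
  obtain ⟨⟨y, c⟩, hy, hmax⟩ := Multiset.exists_max_image (fun p : ι × ℕ => p.2)
    (s := Q) (by rintro rfl; simp at hp₀)
  have hac : a ≤ c := hlt.le.trans (hmax p₀ hp₀)
  obtain ⟨R, rfl⟩ := Multiset.exists_cons_of_mem hy
  have hxy : w x ≤ w y := hw _ hy
  refine ⟨c, (y, a) ::ₘ R, by simp, ?_, ?_, ?_, ?_⟩
  · simp; ring
  · intro p hp
    rcases Multiset.mem_cons.1 hp with rfl | hp
    · exact hac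
    · exact hmax p (Multiset.mem_cons_of_mem hp)
  · exact fun b _ hb => hb _ hy
  · simp only [weightedLength_cons]
    obtain ⟨u, rfl⟩ := Nat.exists_eq_add_of_le hac
    obtain ⟨v, hv⟩ := Nat.exists_eq_add_of_le hxy
    rw [hv]
    nlinarith [Nat.zero_le (v * u)]

/-- A Kraft sum is a multiple of `2 ^ (-d)` if all lengths are at most `d`. -/
theorem kraftSum_eq_mul_pow {ι : Type*} (P : Multiset (ι × ℕ)) (d : ℕ) (h : ∀ p ∈ P, p.2 ≤ d) :
    ∃ j : ℕ, kraftSum P = j * (1 / 2 : ℝ) ^ d := by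
  induction P using Multiset.induction_on with
  | empty => exact ⟨0, by simp [kraftSum]⟩
  | cons p P ih =>
    obtain ⟨j, hj⟩ := ih fun q hq => h q (Multiset.mem_cons_of_mem hq)
    obtain ⟨e, he⟩ := Nat.exists_eq_add_of_le (h p (Multiset.mem_cons_self _ _))
    refine ⟨2 ^ e + j, ?_⟩
    rw [kraftSum_cons, hj, he, pow_add]
    push_cast
    have : (2 : ℝ) ^ e * (1 / 2) ^ e = 1 := by rw [← mul_pow]; norm_num
    linear_combination (-(1 / 2 : ℝ) ^ p.2) * this

/-- Two items of least weights may be made siblings: codeword lengths subject to Kraft's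
inequality can be replaced by lengths that give both items the same length `d + 1` and still
satisfy Kraft's inequality when the two are contracted to one item `z` of length `d`. -/
theorem exists_sibling_lengths_of_le {ι : Type*} (w : ι → ℕ) (x y z : ι) (a b : ℕ)
    (R : Multiset (ι × ℕ)) (hxy : w x ≤ w y) (hR : ∀ p ∈ R.map Prod.fst, w y ≤ w p)
    (hK : kraftSum ((x, a) ::ₘ (y, b) ::ₘ R) ≤ 1) :
    ∃ d R', R'.map Prod.fst = R.map Prod.fst ∧ kraftSum ((z, d) ::ₘ R') ≤ 1 ∧
      (w x + w y) * (d + 1) + weightedLength w R' ≤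
        weightedLength w ((x, a) ::ₘ (y, b) ::ₘ R) := by
  have hR' : ∀ p ∈ R, w y ≤ w p.1 := fun p hp => hR _ (Multiset.mem_map_of_mem _ hp)
  obtain ⟨c, Q, hQ, hQK, hQc, -, hQw⟩ := exists_swap_longest w x a ((y, b) ::ₘ R) (by
    intro p hp
    rcases Multiset.mem_cons.1 hp with rfl | hp
    · exact hxy
    · exact hxy.trans (hR' p hp))
  rw [Multiset.map_cons] at hQ
  have hyQ : y ∈ Q.map Prod.fst := by rw [hQ]; exact Multiset.mem_cons_self _ _
  obtain ⟨⟨y', b'⟩, hmem, rfl⟩ := Multiset.mem_map.1 hyQ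
  obtain ⟨R₁, rfl⟩ := Multiset.exists_cons_of_mem hmem
  rw [Multiset.map_cons, Multiset.cons_inj_right] at hQ
  obtain ⟨d, R₂, hR₂, hK₂, hd, hb, hw₂⟩ := exists_swap_longest w y' b' R₁ (by
    intro p hp
    exact hR _ (hQ ▸ Multiset.mem_map_of_mem _ hp))
  have hdc : d ≤ c := hb c (hQc _ (Multiset.mem_cons_self _ _))
    fun p hp => hQc p (Multiset.mem_cons_of_mem hp)
  obtain ⟨j, hj⟩ := kraftSum_eq_mul_pow R₂ d hd
  have hsum : (1 / 2 : ℝ) ^ c + ((1 / 2 : ℝ) ^ d + j * (1 / 2 : ℝ) ^ d) ≤ 1 := by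
    rw [← hQK] at hK
    rw [kraftSum_cons, ← hK₂, kraftSum_cons, hj] at hK
    exact hK
  -- the remaining Kraft sum is a multiple of `2 ^ (-d)`, so that the length `c ≥ d` of `x` can be
  -- shortened to `d`
  have hpd : (2 : ℝ) ^ d * (1 / 2) ^ d = 1 := by rw [← mul_pow]; norm_num
  have hlt : j + 1 < 2 ^ d := by
    have hc : (0 : ℝ) < (1 / 2) ^ c := by positivity
    have h0 : (0 : ℝ) < (1 / 2) ^ d := by positivity
    have : ((j : ℝ) + 1) * (1 / 2) ^ d < 2 ^ d * (1 / 2) ^ d := by rw [hpd]; linarith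
    have := lt_of_mul_lt_mul_right this h0.le
    exact_mod_cast this
  obtain ⟨e, rfl⟩ : ∃ e, d = e + 1 := by
    cases d with
    | zero => simp at hlt
    | succ e => exact ⟨e, rfl⟩
  refine ⟨e, R₂, hR₂.trans hQ, ?_, ?_⟩
  · rw [kraftSum_cons, hj]
    have h1 : ((j : ℝ) + 2) ≤ 2 ^ (e + 1) := by exact_mod_cast hlt
    have h0 : (0 : ℝ) < (1 / 2) ^ (e + 1) := by positivity
    have h2 := mul_le_mul_of_nonneg_right h1 h0.le
    rw [hpd] at h2
    have h3 : (1 / 2 : ℝ) ^ e = 2 * (1 / 2) ^ (e + 1) := by rw [pow_succ]; ring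
    simp only
    linarith
  · simp only [weightedLength_cons] at hQw hw₂ ⊢
    have : w x * (e + 1) ≤ w x * c := Nat.mul_le_mul_left _ hdc
    nlinarith

theorem exists_sibling_lengths {ι : Type*} (w : ι → ℕ) (x y z : ι) (a b : ℕ)
    (R : Multiset (ι × ℕ)) (hR : ∀ p ∈ R.map Prod.fst, w x ≤ w p ∧ w y ≤ w p)
    (hK : kraftSum ((x, a) ::ₘ (y, b) ::ₘ R) ≤ 1) :
    ∃ d R', R'.map Prod.fst = R.map Prod.fst ∧ kraftSum ((z, d) ::ₘ R') ≤ 1 ∧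
      (w x + w y) * (d + 1) + weightedLength w R' ≤
        weightedLength w ((x, a) ::ₘ (y, b) ::ₘ R) := by
  rcases le_total (w x) (w y) with h | h
  · exact exists_sibling_lengths_of_le w x y z a b R h (fun p hp => (hR p hp).2) hK
  · rw [Multiset.cons_swap] at hK ⊢
    rw [add_comm (w x)]
    exact exists_sibling_lengths_of_le w y x z b a R h (fun p hp => (hR p hp).1) hK

/-- The total cost of the trees of a forest. -/
def forestCost {α : Type*} (w : α → ℕ) (F : Multiset (CodeTree α)) : ℕ :=
  (F.map (CodeTree.cost w)).sum

/-- Optimality of Huffman's algorithm, in the form of an invariant of its steps: codeword lengths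
for the trees of the current forest that satisfy Kraft's inequality give an upper bound on the
cost of the final tree. -/
theorem forestCost_le_of_huffmanSteps {α : Type*} (w : α → ℕ) {F G : Multiset (CodeTree α)}
    (h : Relation.ReflTransGen (HuffmanStep w) F G) (P : Multiset (CodeTree α × ℕ))
    (hP : P.map Prod.fst = F) (hK : kraftSum P ≤ 1) :
    forestCost w G ≤ forestCost w F + weightedLength (CodeTree.weight w) P := by
  induction h using Relation.ReflTransGen.head_induction_on generalizing P with
  | refl => exact Nat.le_add_right _ _
  | head hstep _ ih =>
    obtain ⟨S, T, R, rfl, hmin, rfl⟩ := hstep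
    have hS : S ∈ P.map Prod.fst := by rw [hP]; simp
    obtain ⟨⟨S, a⟩, hmem, rfl⟩ := Multiset.mem_map.1 hS
    obtain ⟨P, rfl⟩ := Multiset.exists_cons_of_mem hmem
    rw [Multiset.map_cons, Multiset.cons_inj_right] at hP
    have hT : T ∈ P.map Prod.fst := by rw [hP]; simp
    obtain ⟨⟨T, b⟩, hmem, rfl⟩ := Multiset.mem_map.1 hT
    obtain ⟨P, rfl⟩ := Multiset.exists_cons_of_mem hmem
    rw [Multiset.map_cons, Multiset.cons_inj_right] at hP
    subst hP
    obtain ⟨d, R', hR', hK', hle⟩ := exists_sibling_lengths (CodeTree.weight w) S T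
      (CodeTree.branch S T) a b P hmin hK
    have := ih ((CodeTree.branch S T, d) ::ₘ R') (by simp [hR']) hK'
    simp only [weightedLength_cons, CodeTree.weight_branch, forestCost, Multiset.map_cons,
      Multiset.sum_cons, CodeTree.cost] at this hle ⊢
    linarith

/-- The steps of Huffman's algorithm preserve the multiset of letters of the forest. -/
theorem letters_eq_of_huffmanSteps {α : Type*} (w : α → ℕ) {F G : Multiset (CodeTree α)}
    (h : Relation.ReflTransGen (HuffmanStep w) F G) :
    (G.map fun T => (T.letters : Multiset α)).sum =
      (F.map fun T => (T.letters : Multiset α)).sum := by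
  induction h with
  | refl => rfl
  | tail _ hstep ih =>
    obtain ⟨S, T, R, rfl, -, rfl⟩ := hstep
    rw [← ih]
    simp [CodeTree.letters, ← Multiset.coe_add, add_assoc]

theorem sum_count_mul {α : Type*} [DecidableEq α] (s : List α) (f : α → ℕ) :
    (s.map f).sum = ∑ a ∈ s.toFinset, s.count a * f a := by
  rw [Finset.sum_list_map_count]
  simp

/-- A Huffman code is at least as short as any assignment of codeword lengths that satisfies
Kraft's inequality. -/
theorem IsHuffmanCode.sum_length_le {α : Type*} [DecidableEq α] {s : List α}
    {C : α → List Bool} (hC : IsHuffmanCode s C) (len : α → ℕ)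
    (hlen : ∑ a ∈ s.toFinset, (1 / 2 : ℝ) ^ len a ≤ 1) :
    (s.map fun a => (C a).length).sum ≤ (s.map len).sum := by
  obtain ⟨G, hrun, hcard, hG⟩ := hC
  have hle := forestCost_le_of_huffmanSteps _ hrun
    (s.toFinset.val.map fun a => (CodeTree.leaf a, len a))
    (by rw [Multiset.map_map]; rfl)
    (by rw [kraftSum, Multiset.map_map]; exact hlen)
  have hlet := letters_eq_of_huffmanSteps _ hrun
  have h1 : ((s.toFinset.val.map CodeTree.leaf).map
      fun T => ((T : CodeTree α).letters : Multiset α)).sum = s.toFinset.val := by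
    rw [Multiset.map_map]
    exact Multiset.sum_map_singleton _
  have h2 : forestCost (fun a => s.count a) (s.toFinset.val.map CodeTree.leaf) = 0 := by
    rw [forestCost, Multiset.map_map]
    exact Finset.sum_eq_zero (s := s.toFinset) fun _ _ => rfl
  have h3 : weightedLength (CodeTree.weight fun a => s.count a)
      (s.toFinset.val.map fun a => (CodeTree.leaf a, len a)) = (s.map len).sum := by
    rw [sum_count_mul, weightedLength, Multiset.map_map]
    exact Finset.sum_congr (s₁ := s.toFinset) rfl fun a _ => by
      simp [CodeTree.weight, CodeTree.letters]
  rw [h2, h3, zero_add] at hle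
  refine le_trans (le_of_eq ?_) hle
  rw [sum_count_mul]
  rw [h1] at hlet
  rcases Nat.le_one_iff_eq_zero_or_eq_one.1 hcard with h | h
  · rw [Multiset.card_eq_zero] at h
    subst h
    have : s.toFinset = ∅ := by
      rw [← Finset.val_eq_zero, ← hlet]; simp
    rw [this]
    simp [forestCost]
  · obtain ⟨T, rfl⟩ := Multiset.card_eq_one.1 h
    rw [Multiset.map_singleton, Multiset.sum_singleton] at hlet
    have hnd : T.letters.Nodup := by
      rw [← Multiset.coe_nodup, hlet]
      exact s.toFinset.nodup
    have := CodeTree.sum_length_codeword (fun a => s.count a) T hnd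
    rw [forestCost, Multiset.map_singleton, Multiset.sum_singleton, ← this,
      ← Multiset.sum_coe, ← Multiset.map_coe, hlet]
    exact Finset.sum_congr rfl fun a ha => by
      rw [hG T (Multiset.mem_singleton_self _) a (List.mem_toFinset.1 ha)]

/-! ### Type processes with one modified node -/

/-- The history of the children of a node with history `h` and type `i`. A node of type `0` has no
children; the value `h` in this case makes the function total. -/
def extendHistory (h : List InnerType) (i : Fin 4) : List InnerType :=
  if hi : i ≠ 0 then h ++ [⟨i, hi⟩] else h

/-- The probability of a subtree whose root has history `h`. -/
noncomputable def TypeProcess.probFrom {k : ℕ} (τ : TypeProcess k) :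
    List InnerType → Shape → ℝ
  | _, .nil => 1
  | h, .node _ l r =>
    (τ (kHistory k h)).1 (nodeType l r) *
      (probFrom τ (extendHistory h (nodeType l r)) l *
        probFrom τ (extendHistory h (nodeType l r)) r)

theorem TypeProcess.prob_nodesFrom {k : ℕ} (τ : TypeProcess k) (h : List InnerType) (t : Shape) :
    ((nodesFrom h t).map fun p => (τ (kHistory k p.1)).1 p.2).prod = τ.probFrom h t := by
  induction t generalizing h with
  | nil => simp [nodesFrom, probFrom]
  | node _ l r ihl ihr =>
    rw [nodesFrom, probFrom, List.map_cons, List.prod_cons]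
    by_cases ht : nodeType l r = 0
    · have hl : l = .nil ∧ r = .nil := by
        cases l <;> cases r <;> simp_all [nodeType, isNode]
      obtain ⟨rfl, rfl⟩ := hl
      simp [ht, probFrom]
    · simp [ht, ihl, ihr, extendHistory]

theorem TypeProcess.prob_eq_probFrom {k : ℕ} (τ : TypeProcess k) (t : Shape) :
    τ.prob t = τ.probFrom [] t := by
  rw [← τ.prob_nodesFrom, prob, typedNodes, List.map_map]
  rfl

theorem TypeProcess.probFrom_nonneg {k : ℕ} (τ : TypeProcess k) (h : List InnerType)
    (t : Shape) : 0 ≤ τ.probFrom h t := by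
  induction t generalizing h with
  | nil => simp [probFrom]
  | node _ l r ihl ihr =>
    exact mul_nonneg ((τ _).2.1 _) (mul_nonneg (ihl _) (ihr _))

theorem TypeProcess.apply_le_one {k : ℕ} (τ : TypeProcess k) (z : List.Vector InnerType k)
    (i : Fin 4) : (τ z).1 i ≤ 1 := by
  rw [← (τ z).2.2]
  exact Finset.single_le_sum (fun j _ => (τ z).2.1 j) (Finset.mem_univ i)

/-- The probability that a type process generates a tree when it is started with history `h` and
modified at the node with index `e` in preorder (counted from `0`; indices outside the tree
modify nothing): at this node all four types are equally likely, and for the histories of its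
descendants it counts as a node of type `a`. -/
noncomputable def TypeProcess.modProb {k : ℕ} (τ : TypeProcess k) (a : Fin 4) :
    List InnerType → ℤ → Shape → ℝ
  | _, _, .nil => 1
  | h, e, .node _ l r =>
    (if e = 0 then 1 / 4 else (τ (kHistory k h)).1 (nodeType l r)) *
      (modProb τ a (extendHistory h (if e = 0 then a else nodeType l r)) (e - 1) l *
        modProb τ a (extendHistory h (if e = 0 then a else nodeType l r))
          (e - 1 - l.numNodes) r)

theorem TypeProcess.modProb_nonneg {k : ℕ} (τ : TypeProcess k) (a : Fin 4)
    (h : List InnerType) (e : ℤ) (t : Shape) : 0 ≤ τ.modProb a h e t := by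
  induction t generalizing h e with
  | nil => simp [modProb]
  | node _ l r ihl ihr =>
    refine mul_nonneg ?_ (mul_nonneg (ihl _ _) (ihr _ _))
    split_ifs
    · norm_num
    · exact (τ _).2.1 _

theorem TypeProcess.modProb_eq_probFrom {k : ℕ} (τ : TypeProcess k) (a : Fin 4)
    (h : List InnerType) (e : ℤ) (t : Shape) (he : e < 0 ∨ (t.numNodes : ℤ) ≤ e) :
    τ.modProb a h e t = τ.probFrom h t := by
  induction t generalizing h e with
  | nil => simp [modProb, probFrom]
  | node _ l r ihl ihr =>
    simp only [BinaryTree.numNodes, Nat.cast_add, Nat.cast_one] at he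
    have h0 : e ≠ 0 := by omega
    rw [modProb, probFrom, if_neg h0, if_neg h0, ihl _ _ (by omega), ihr _ _ (by omega)]

/-- Only those entries of the start history matter that enter the `k`-histories of descendants. -/
theorem TypeProcess.modProb_congr {k : ℕ} (τ : TypeProcess k) (a : Fin 4)
    (h h' : List InnerType) (hh : ∀ g, kHistory k (h ++ g) = kHistory k (h' ++ g))
    (e : ℤ) (t : Shape) : τ.modProb a h e t = τ.modProb a h' e t := by
  induction t generalizing h h' e with
  | nil => simp [modProb]
  | node _ l r ihl ihr =>
    have h1 : kHistory k h = kHistory k h' := by simpa using hh []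
    have h2 : ∀ i g, kHistory k (extendHistory h i ++ g) =
        kHistory k (extendHistory h' i ++ g) := by
      intro i g
      unfold extendHistory
      split_ifs
      · rw [List.append_assoc, List.append_assoc, hh]
      · exact hh g
    rw [modProb, modProb, h1, ihl _ _ (h2 _), ihr _ _ (h2 _)]

/-- The `k`-history of a node determines the `k`-histories of its descendants. -/
theorem kHistory_toList_append (k : ℕ) (h g : List InnerType) :
    kHistory k ((kHistory k h).toList ++ g) = kHistory k (h ++ g) := by
  have hlen : ((kHistory k h).toList).length = k := (kHistory k h).2
  apply List.Vector.toList_injective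
  change List.drop _ _ = List.drop _ _
  rw [List.length_append, hlen, List.drop_append, List.length_replicate,
    List.drop_eq_nil_of_le (by simp), List.nil_append, Nat.add_sub_cancel_left,
    ← List.append_assoc, List.length_append, ← List.drop_drop]
  congr 1
  rw [List.drop_append_of_le_length (by simp)]
  rfl

/-- The type of a node, given whether it has a left and whether it has a right child. -/
def typeOfChildren : Bool → Bool → Fin 4
  | false, false => 0
  | true, false => 1
  | true, true => 2
  | false, true => 3

theorem nodeType_eq (l r : Shape) : nodeType l r = typeOfChildren (isNode l) (isNode r) := by
  cases l <;> cases r <;> rfl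

theorem sum_typeOfChildren (f : Fin 4 → ℝ) :
    ∑ b : Bool, ∑ b' : Bool, f (typeOfChildren b b') = ∑ i, f i := by
  simp [Fin.sum_univ_four, typeOfChildren]
  ring

/-- The probabilities with which a modified process generates the finite trees with a root add
up to at most one, and so do those for which it generates the empty tree; with `b` saying which of
the two cases is meant, the statement applies to both subtrees of the root, once its type is
known. -/
theorem TypeProcess.sum_modProb_le_one_of_height {k : ℕ} (τ : TypeProcess k) (a : Fin 4) (N : ℕ)
    (h : List InnerType) (e : ℤ) (S : Finset Shape) (b : Bool) (hb : ∀ s ∈ S, isNode s = b)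
    (hN : ∀ s ∈ S, s.height ≤ N) : ∑ s ∈ S, τ.modProb a h e s ≤ 1 := by
  induction N generalizing h e S b with
  | zero =>
    have : S ⊆ {.nil} := by
      intro s hs
      have := hN s hs
      cases s with
      | nil => simp
      | node => simp at this
    exact (Finset.sum_le_sum_of_subset_of_nonneg this fun s _ _ => modProb_nonneg τ a h e s).trans
      (by simp [modProb])
  | succ N ih =>
    cases b with
    | false =>
      have : S ⊆ {.nil} := by
        intro s hs
        have := hb s hs
        cases s with
        | nil => simp
        | node => simp [isNode] at this
      exact (Finset.sum_le_sum_of_subset_of_nonneg this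
        fun s _ _ => modProb_nonneg τ a h e s).trans (by simp [modProb])
    | true =>
      let D : Finset Shape := S.image BinaryTree.left ∪ S.image BinaryTree.right
      have hD : ∀ s ∈ D, s.height ≤ N := by
        intro s hs
        rcases Finset.mem_union.1 hs with hs | hs <;>
          obtain ⟨u, hu, rfl⟩ := Finset.mem_image.1 hs <;> have hu' := hN u hu <;>
          cases u <;> simp at hu' ⊢ <;> omega
      have hsub : S ⊆ (D ×ˢ D).image fun p => BinaryTree.node () p.1 p.2 := by
        intro s hs
        have hs' := hb s hs
        cases s with
        | nil => simp [isNode] at hs'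
        | node u l r =>
          exact Finset.mem_image.2 ⟨(l, r), Finset.mem_product.2
            ⟨Finset.mem_union_left _ (Finset.mem_image.2 ⟨_, hs, rfl⟩),
              Finset.mem_union_right _ (Finset.mem_image.2 ⟨_, hs, rfl⟩)⟩, rfl⟩
      refine (Finset.sum_le_sum_of_subset_of_nonneg hsub
        fun s _ _ => modProb_nonneg τ a h e s).trans ?_
      rw [Finset.sum_image (by rintro ⟨l, r⟩ - ⟨l', r'⟩ - hlr; simpa using hlr),
        Finset.sum_product, ← Finset.sum_fiberwise D isNode]
      -- the root contributes the probability of its type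
      let p : Fin 4 → ℝ := fun i => if e = 0 then 1 / 4 else (τ (kHistory k h)).1 i
      have hp0 : ∀ i, 0 ≤ p i := by
        intro i
        simp only [p]
        split_ifs
        · norm_num
        · exact (τ _).2.1 i
      have hp : ∑ b : Bool, ∑ b' : Bool, p (typeOfChildren b b') = 1 := by
        rw [sum_typeOfChildren]
        simp only [p]
        split_ifs
        · norm_num
        · exact (τ _).2.2
      rw [← hp]
      refine Finset.sum_le_sum fun b _ => ?_
      rw [Finset.sum_congr rfl fun l _ => (Finset.sum_fiberwise D isNode _).symm,
        Finset.sum_comm]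
      refine Finset.sum_le_sum fun b' _ => ?_
      let g := extendHistory h (if e = 0 then a else typeOfChildren b b')
      have key : ∀ l ∈ D.filter (isNode · = b), ∑ r ∈ D.filter (isNode · = b'),
          τ.modProb a h e (.node () l r) ≤
            p (typeOfChildren b b') * τ.modProb a g (e - 1) l := by
        intro l hl
        have hl' := (Finset.mem_filter.1 hl).2
        have : ∀ r ∈ D.filter (isNode · = b'), τ.modProb a h e (.node () l r) =
            (p (typeOfChildren b b') * τ.modProb a g (e - 1) l) *
              τ.modProb a g (e - 1 - l.numNodes) r := by
          intro r hr
          have hr' := (Finset.mem_filter.1 hr).2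
          rw [modProb, nodeType_eq, hl', hr']
          simp only [p, g]
          ring
        rw [Finset.sum_congr rfl this, ← Finset.mul_sum]
        refine mul_le_of_le_one_right
          (mul_nonneg (hp0 _) (modProb_nonneg _ _ _ _ _)) ?_
        exact ih _ _ _ b' (fun s hs => (Finset.mem_filter.1 hs).2)
          fun s hs => hD s (Finset.mem_filter.1 hs).1
      refine (Finset.sum_le_sum key).trans ?_
      rw [← Finset.mul_sum]
      refine mul_le_of_le_one_right (hp0 _) ?_
      exact ih _ _ _ b (fun s hs => (Finset.mem_filter.1 hs).2)
        fun s hs => hD s (Finset.mem_filter.1 hs).1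

theorem TypeProcess.sum_modProb_le_one {k : ℕ} (τ : TypeProcess k) (a : Fin 4)
    (h : List InnerType) (e : ℤ) (S : Finset Shape) (hS : ∀ s ∈ S, s ≠ .nil) :
    ∑ s ∈ S, τ.modProb a h e s ≤ 1 := by
  refine τ.sum_modProb_le_one_of_height a (S.sup BinaryTree.height) h e S true ?_
    fun s hs => Finset.le_sup (f := BinaryTree.height) hs
  intro s hs
  have := hS s hs
  cases s <;> simp_all [isNode]

/-- There are at most `4 ^ N` nonempty binary trees with at most `N` nodes: the process for which
all types are equally likely generates each of them with probability at least `4 ^ (-N)`. -/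
theorem card_shapes_le (S : Finset Shape) (N : ℕ) (hS : ∀ s ∈ S, s ≠ .nil)
    (hN : ∀ s ∈ S, s.numNodes ≤ N) : S.card ≤ 4 ^ N := by
  let τ : TypeProcess 0 := fun _ => ⟨fun _ => 1 / 4, fun _ => by norm_num, by norm_num⟩
  have hτ : ∀ (s : Shape) (h : List InnerType) (e : ℤ),
      τ.modProb 0 h e s = (1 / 4 : ℝ) ^ s.numNodes := by
    intro s
    induction s with
    | nil => intro h e; simp [TypeProcess.modProb]
    | node _ l r ihl ihr =>
      intro h e
      rw [TypeProcess.modProb, ihl, ihr]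
      simp only [τ, ite_self, BinaryTree.numNodes]
      rw [pow_add, pow_add]
      ring
  have h1 : ∑ _s ∈ S, (1 / 4 : ℝ) ^ N ≤ 1 := by
    refine le_trans (Finset.sum_le_sum fun s hs => ?_) (τ.sum_modProb_le_one 0 [] 0 S hS)
    rw [hτ]
    exact pow_le_pow_of_le_one (by norm_num) (by norm_num) (hN s hs)
  rw [Finset.sum_const, nsmul_eq_mul, one_div, inv_pow, ← div_eq_mul_inv,
    div_le_one (by positivity)] at h1
  exact_mod_cast h1

/-! ### Structure of the tree covering -/

/-- The underlying tree of a tree whose cut edges are marked. -/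
abbrev skeleton (u : BinaryTree (Bool × Bool)) : Shape := u.map fun _ => ()

/-- No edge is cut. -/
def CutFree : BinaryTree (Bool × Bool) → Prop
  | .nil => True
  | .node c l r => c = (false, false) ∧ CutFree l ∧ CutFree r

/-- All portals of the component of the root belong to the same node. -/
def SinglePortalNode : BinaryTree (Bool × Bool) → Prop
  | .nil => True
  | .node c l r =>
    ((c.1 = true ∨ CutFree l) ∧ (c.2 = true ∨ CutFree r)) ∨
      (c = (false, false) ∧ (SinglePortalNode l ∧ CutFree r ∨ CutFree l ∧ SinglePortalNode r))

/-- Every component has fewer than `2 * B` nodes, and its portals belong to a single node. -/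
def GoodCover (B : ℕ) : BinaryTree (Bool × Bool) → Prop
  | .nil => True
  | .node c l r =>
    SinglePortalNode (.node c l r) ∧ (localShape (.node c l r)).numNodes < 2 * B ∧
      GoodCover B l ∧ GoodCover B r

/-- The number of cut edges. -/
def numCuts : BinaryTree (Bool × Bool) → ℕ
  | .nil => 0
  | .node c l r => c.1.toNat + c.2.toNat + numCuts l + numCuts r

theorem CutFree.numCuts_eq_zero {u : BinaryTree (Bool × Bool)} (h : CutFree u) :
    numCuts u = 0 := by
  induction u with
  | nil => rfl
  | node c l r ihl ihr =>
    obtain ⟨rfl, hl, hr⟩ := h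
    simp [numCuts, ihl hl, ihr hr]

theorem CutFree.localShape_eq {u : BinaryTree (Bool × Bool)} (h : CutFree u) :
    localShape u = skeleton u := by
  induction u with
  | nil => rfl
  | node c l r ihl ihr =>
    obtain ⟨rfl, hl, hr⟩ := h
    simp [localShape, skeleton, BinaryTree.map, ihl hl, ihr hr]

theorem isNode_localShape (u : BinaryTree (Bool × Bool)) :
    isNode (localShape u) = isNode (skeleton u) := by
  cases u <;> rfl

theorem farzanMunro_node_of_heavy {B : ℕ} {l r : Shape} (h : IsHeavy B l ∧ IsHeavy B r)
    (x : Unit) : farzanMunro B (.node x l r) =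
      ⟨.node (true, true) (farzanMunro B l).cuts (farzanMunro B r).cuts, 1, true⟩ := by
  rw [farzanMunro, if_pos h]

/-- The size of the component of a node whose children are not both heavy. -/
def mergedSize (B : ℕ) (l r : Shape) : ℕ :=
  1 + (if (farzanMunro B l).permanent then 0 else (farzanMunro B l).size) +
    (if (farzanMunro B r).permanent then 0 else (farzanMunro B r).size)

theorem farzanMunro_node_of_not_heavy {B : ℕ} {l r : Shape}
    (h : ¬ (IsHeavy B l ∧ IsHeavy B r)) (x : Unit) : farzanMunro B (.node x l r) =
      ⟨.node ((farzanMunro B l).permanent, (farzanMunro B r).permanent)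
        (farzanMunro B l).cuts (farzanMunro B r).cuts, mergedSize B l r,
        decide (B ≤ mergedSize B l r)⟩ := by
  rw [farzanMunro, if_neg h]
  rfl

theorem skeleton_farzanMunro (B : ℕ) (t : Shape) : skeleton (farzanMunro B t).cuts = t := by
  induction t with
  | nil => rfl
  | node _ l r ihl ihr =>
    unfold skeleton at ihl ihr ⊢
    by_cases h : IsHeavy B l ∧ IsHeavy B r
    · rw [farzanMunro_node_of_heavy h]
      simp [BinaryTree.map, ihl, ihr]
    · rw [farzanMunro_node_of_not_heavy h]
      simp [BinaryTree.map, ihl, ihr]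

theorem isHeavy_iff {B : ℕ} (hB : 1 ≤ B) (t : Shape) : IsHeavy B t ↔ B ≤ t.numNodes := by
  refine ⟨fun h => h.2, fun h => ⟨?_, h⟩⟩
  rintro rfl
  simp at h
  omega

theorem farzanMunro_of_light {B : ℕ} (t : Shape) (ht : t.numNodes < B) :
    CutFree (farzanMunro B t).cuts ∧ (farzanMunro B t).permanent = false ∧
      (farzanMunro B t).size = t.numNodes := by
  induction t with
  | nil => exact ⟨trivial, rfl, rfl⟩
  | node _ l r ihl ihr =>
    simp only [BinaryTree.numNodes] at ht
    obtain ⟨hl, hl', hl''⟩ := ihl (by omega)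
    obtain ⟨hr, hr', hr''⟩ := ihr (by omega)
    have : ¬ (IsHeavy B l ∧ IsHeavy B r) := fun h => by have := h.1.2; omega
    rw [farzanMunro_node_of_not_heavy this]
    simp only [mergedSize, hl', hr', hl'', hr'', CutFree, BinaryTree.numNodes]
    refine ⟨⟨trivial, hl, hr⟩, ?_, ?_⟩ <;> simp <;> omega

theorem size_farzanMunro (B : ℕ) (t : Shape) :
    (farzanMunro B t).size = (localShape (farzanMunro B t).cuts).numNodes := by
  induction t with
  | nil => rfl
  | node _ l r ihl ihr =>
    by_cases h : IsHeavy B l ∧ IsHeavy B r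
    · rw [farzanMunro_node_of_heavy h]
      simp [localShape]
    · rw [farzanMunro_node_of_not_heavy h]
      simp only [mergedSize, localShape, BinaryTree.numNodes, ihl, ihr,
        apply_ite BinaryTree.numNodes]
      omega

theorem size_lt_of_not_permanent {B : ℕ} (hB : 1 ≤ B) (t : Shape)
    (ht : (farzanMunro B t).permanent = false) : (farzanMunro B t).size < B := by
  cases t with
  | nil => exact hB
  | node _ l r =>
    by_cases h : IsHeavy B l ∧ IsHeavy B r
    · rw [farzanMunro_node_of_heavy h] at ht
      simp at ht
    · rw [farzanMunro_node_of_not_heavy h] at ht ⊢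
      simpa using ht

theorem size_lt_two_mul {B : ℕ} (hB : 1 ≤ B) (t : Shape) : (farzanMunro B t).size < 2 * B := by
  cases t with
  | nil => simp [farzanMunro]; omega
  | node _ l r =>
    have hl := size_lt_of_not_permanent hB l
    have hr := size_lt_of_not_permanent hB r
    by_cases h : IsHeavy B l ∧ IsHeavy B r
    · rw [farzanMunro_node_of_heavy h]
      simp; omega
    · rw [farzanMunro_node_of_not_heavy h]
      simp only [mergedSize]
      cases h1 : (farzanMunro B l).permanent <;> cases h2 : (farzanMunro B r).permanent <;>
        simp [h1, h2] at hl hr ⊢ <;> omega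

/-- If not both children of a node are heavy, the light one lies in the component of the node
without a portal. -/
theorem singlePortalNode_farzanMunro {B : ℕ} (hB : 1 ≤ B) (t : Shape) :
    SinglePortalNode (farzanMunro B t).cuts := by
  induction t with
  | nil => trivial
  | node _ l r ihl ihr =>
    by_cases h : IsHeavy B l ∧ IsHeavy B r
    · rw [farzanMunro_node_of_heavy h]
      exact Or.inl ⟨Or.inl rfl, Or.inl rfl⟩
    · rw [farzanMunro_node_of_not_heavy h]
      simp only [isHeavy_iff hB, not_and_or, not_le] at h
      rcases h with h | h
      · obtain ⟨hc, hp, -⟩ := farzanMunro_of_light l h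
        by_cases h2 : (farzanMunro B r).permanent = true
        · exact Or.inl ⟨Or.inr hc, Or.inl h2⟩
        · exact Or.inr ⟨by simp [hp, h2], Or.inr ⟨hc, ihr⟩⟩
      · obtain ⟨hc, hp, -⟩ := farzanMunro_of_light r h
        by_cases h2 : (farzanMunro B l).permanent = true
        · exact Or.inl ⟨Or.inl h2, Or.inr hc⟩
        · exact Or.inr ⟨by simp [hp, h2], Or.inl ⟨ihl, hc⟩⟩

theorem goodCover_farzanMunro {B : ℕ} (hB : 1 ≤ B) (t : Shape) :
    GoodCover B (farzanMunro B t).cuts := by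
  induction t with
  | nil => trivial
  | node x l r ihl ihr =>
    have h1 := singlePortalNode_farzanMunro hB (.node x l r)
    have h2 := size_lt_two_mul hB (.node x l r)
    rw [size_farzanMunro] at h2
    by_cases h : IsHeavy B l ∧ IsHeavy B r
    · rw [farzanMunro_node_of_heavy h] at h1 h2 ⊢
      exact ⟨h1, h2, ihl, ihr⟩
    · rw [farzanMunro_node_of_not_heavy h] at h1 h2 ⊢
      exact ⟨h1, h2, ihl, ihr⟩

/-- The potential argument that bounds the number of cut edges. A node with two heavy children
cuts two edges, and pays for them and for its own component of size `1`, which is permanent, with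
the potential `3 * B` of one of the children. -/
theorem numCuts_farzanMunro_le {B : ℕ} (hB : 1 ≤ B) (t : Shape) (ht : B ≤ t.numNodes) :
    B * numCuts (farzanMunro B t).cuts + 3 * B +
      (if (farzanMunro B t).permanent then B else (farzanMunro B t).size) ≤ 4 * t.numNodes := by
  induction t with
  | nil => simp at ht; omega
  | node x l r ihl ihr =>
    by_cases h : IsHeavy B l ∧ IsHeavy B r
    · rw [farzanMunro_node_of_heavy h]
      have hl := Nat.le_of_add_right_le (ihl h.1.2)
      have hr := Nat.le_of_add_right_le (ihr h.2.2)
      simp only [numCuts, Bool.toNat_true, BinaryTree.numNodes, if_true, mul_add, mul_one]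
      omega
    · rw [farzanMunro_node_of_not_heavy h]
      simp only [isHeavy_iff hB, not_and_or, not_le] at h
      simp only [BinaryTree.numNodes] at ht ⊢
      have hmin : (if decide (B ≤ mergedSize B l r) = true then B else mergedSize B l r) ≤
          mergedSize B l r := by
        split_ifs with h'
        · simpa using h'
        · exact le_rfl
      have hmin' : (if decide (B ≤ mergedSize B l r) = true then B else mergedSize B l r) ≤
          B := by
        split_ifs with h'
        · exact le_rfl
        · simp at h'; omega
      refine le_trans (Nat.add_le_add_left (le_min hmin hmin') _) ?_
      simp only [mergedSize, numCuts]
      by_cases hl : l.numNodes < B <;> by_cases hr : r.numNodes < B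
      · obtain ⟨hcl, hpl, hsl⟩ := farzanMunro_of_light l hl
        obtain ⟨hcr, hpr, hsr⟩ := farzanMunro_of_light r hr
        simp [hpl, hpr, hcl.numCuts_eq_zero, hcr.numCuts_eq_zero, hsl, hsr]
        omega
      · obtain ⟨hcl, hpl, hsl⟩ := farzanMunro_of_light l hl
        have := ihr (not_lt.1 hr)
        cases hp : (farzanMunro B r).permanent <;>
          simp [hpl, hcl.numCuts_eq_zero, hsl, hp, mul_add] at this ⊢ <;> omega
      · obtain ⟨hcr, hpr, hsr⟩ := farzanMunro_of_light r hr
        have := ihl (not_lt.1 hl)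
        cases hp : (farzanMunro B l).permanent <;>
          simp [hpr, hcr.numCuts_eq_zero, hsr, hp, mul_add] at this ⊢ <;> omega
      · omega

/-- Passing from a list to its first element with property `p` does not increase a sum. -/
theorem sum_map_find? {α : Type*} (p : α → Bool) (f : α → ℕ) (x : α) (hx : f x = 0)
    (l : List α) : f ((l.find? p).getD x) ≤ (l.map f).sum := by
  cases h : l.find? p with
  | none => simp [hx]
  | some y =>
    exact List.single_le_sum (by simp) _ (List.mem_map_of_mem (List.mem_of_find?_eq_some h))

/-- Each micro tree but that of the root is attached by a cut edge. Equality may fail, because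
`contract` keeps only the first portal on each side of the root. -/
theorem numNodes_contract_le (u : BinaryTree (Bool × Bool)) :
    (contract u).1.numNodes ≤ numCuts u + 1 ∧
      ((contract u).2.map BinaryTree.numNodes).sum ≤ numCuts u := by
  induction u with
  | nil => simp [contract]
  | node c l r ihl ihr =>
    have hl : ((if c.1 then [(contract l).1] else (contract l).2).map
        BinaryTree.numNodes).sum ≤ c.1.toNat + numCuts l := by
      cases c.1 <;> simp <;> omega
    have hr : ((if c.2 then [(contract r).1] else (contract r).2).map
        BinaryTree.numNodes).sum ≤ c.2.toNat + numCuts r := by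
      cases c.2 <;> simp <;> omega
    have h1 := sum_map_find? isNode BinaryTree.numNodes .nil rfl
      (if c.1 then [(contract l).1] else (contract l).2)
    have h2 := sum_map_find? isNode BinaryTree.numNodes .nil rfl
      (if c.2 then [(contract r).1] else (contract r).2)
    rw [contract]
    simp only [BinaryTree.numNodes, portalTarget, numCuts, List.map_append, List.sum_append]
    omega

/-- There are at most `4 * n / B` micro trees. -/
theorem mul_numNodes_topTier_le {B : ℕ} (hB : 1 ≤ B) (t : Shape) (ht : B ≤ t.numNodes) :
    B * (topTier B t).numNodes ≤ 4 * t.numNodes := by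
  have h1 := numCuts_farzanMunro_le hB t ht
  have h2 := Nat.mul_le_mul_left B (numNodes_contract_le (farzanMunro B t).cuts).1
  rw [topTier]
  rw [mul_add] at h2
  omega

/-- Micro trees are nonempty and have fewer than `2 * B` nodes. The second part, on the micro trees
below the component of the root, carries the induction. -/
theorem forall_mem_preorder_contract {B : ℕ} (u : BinaryTree (Bool × Bool))
    (hu : GoodCover B u) :
    (∀ M ∈ preorder (contract u).1, M.shape ≠ .nil ∧ M.shape.numNodes < 2 * B) ∧
      ∀ v ∈ (contract u).2, ∀ M ∈ preorder v, M.shape ≠ .nil ∧ M.shape.numNodes < 2 * B := by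
  induction u with
  | nil => simp [contract, preorder]
  | node c l r ihl ihr =>
    obtain ⟨-, hs, hl, hr⟩ := hu
    have hl' : ∀ v ∈ (if c.1 then [(contract l).1] else (contract l).2),
        ∀ M ∈ preorder v, M.shape ≠ .nil ∧ M.shape.numNodes < 2 * B := by
      split_ifs
      · simpa using (ihl hl).1
      · exact (ihl hl).2
    have hr' : ∀ v ∈ (if c.2 then [(contract r).1] else (contract r).2),
        ∀ M ∈ preorder v, M.shape ≠ .nil ∧ M.shape.numNodes < 2 * B := by
      split_ifs
      · simpa using (ihr hr).1
      · exact (ihr hr).2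
    have hfind : ∀ ps : List (BinaryTree MicroTree),
        (∀ v ∈ ps, ∀ M ∈ preorder v, M.shape ≠ .nil ∧ M.shape.numNodes < 2 * B) →
        ∀ M ∈ preorder (portalTarget ps), M.shape ≠ .nil ∧ M.shape.numNodes < 2 * B := by
      intro ps hps
      rw [portalTarget]
      cases h : ps.find? isNode with
      | none => simp [preorder]
      | some v => exact hps v (List.mem_of_find?_eq_some h)
    rw [contract]
    refine ⟨?_, ?_⟩
    · intro M hM
      simp only [preorder, List.mem_cons, List.mem_append] at hM
      rcases hM with rfl | hM | hM
      · exact ⟨by simp [localShape], hs⟩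
      · exact hfind _ hl' M hM
      · exact hfind _ hr' M hM
    · intro v hv
      rcases List.mem_append.1 hv with hv | hv
      · exact hl' v hv
      · exact hr' v hv

/-! ### The probability of a tree and of its micro trees -/

/-- The product of the probabilities of the types of the nodes in the component of the root,
where types and histories refer to the whole tree. -/
noncomputable def TypeProcess.compProb {k : ℕ} (τ : TypeProcess k) :
    List InnerType → BinaryTree (Bool × Bool) → ℝ
  | _, .nil => 1
  | h, .node c l r =>
    (τ (kHistory k h)).1 (nodeType (skeleton l) (skeleton r)) *
      ((if c.1 then 1
        else compProb τ (extendHistory h (nodeType (skeleton l) (skeleton r))) l) *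
      (if c.2 then 1
        else compProb τ (extendHistory h (nodeType (skeleton l) (skeleton r))) r))

theorem TypeProcess.compProb_nonneg {k : ℕ} (τ : TypeProcess k) (h : List InnerType)
    (u : BinaryTree (Bool × Bool)) : 0 ≤ τ.compProb h u := by
  induction u generalizing h with
  | nil => simp [compProb]
  | node c l r ihl ihr =>
    refine mul_nonneg ((τ _).2.1 _) (mul_nonneg ?_ ?_) <;> split_ifs <;> simp [ihl, ihr]

theorem TypeProcess.compProb_le_one {k : ℕ} (τ : TypeProcess k) (h : List InnerType)
    (u : BinaryTree (Bool × Bool)) : τ.compProb h u ≤ 1 := by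
  induction u generalizing h with
  | nil => simp [compProb]
  | node c l r ihl ihr =>
    rw [compProb]
    refine mul_le_one₀ (τ.apply_le_one _ _) (mul_nonneg ?_ ?_) (mul_le_one₀ ?_ ?_ ?_) <;>
      split_ifs <;> simp [ihl, ihr, compProb_nonneg]

theorem TypeProcess.compProb_of_cutFree {k : ℕ} (τ : TypeProcess k) (h : List InnerType)
    (u : BinaryTree (Bool × Bool)) (hu : CutFree u) :
    τ.compProb h u = τ.probFrom h (localShape u) := by
  rw [hu.localShape_eq]
  induction u generalizing h with
  | nil => rfl
  | node c l r ihl ihr =>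
    obtain ⟨rfl, hl, hr⟩ := hu
    simp only [compProb, Bool.false_eq_true, if_false, ihl _ hl, ihr _ hr]
    rfl

/-- Types and histories in a micro tree agree with those in the whole tree once the process is
modified at the node that owns the portals. -/
theorem TypeProcess.exists_compProb_le_modProb {k : ℕ} (τ : TypeProcess k) (h : List InnerType)
    (u : BinaryTree (Bool × Bool)) (hu : SinglePortalNode u) (hne : u ≠ .nil) :
    ∃ (a : Fin 4) (e : ℕ), e < (localShape u).numNodes ∧
      τ.compProb h u ≤ 4 * τ.modProb a h e (localShape u) := by
  induction u generalizing h with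
  | nil => exact absurd rfl hne
  | node c l r ihl ihr =>
    set i := nodeType (skeleton l) (skeleton r) with hi
    -- the root owns the portals
    have root : (c.1 = true ∨ CutFree l) → (c.2 = true ∨ CutFree r) →
        ∃ (a : Fin 4) (e : ℕ), e < (localShape (.node c l r)).numNodes ∧
          τ.compProb h (.node c l r) ≤ 4 * τ.modProb a h e (localShape (.node c l r)) := by
      intro hl hr
      refine ⟨i, 0, by simp [localShape], ?_⟩
      rw [localShape, modProb, compProb, ← hi]
      simp only [Nat.cast_zero, if_true]
      rw [modProb_eq_probFrom _ _ _ _ _ (by omega), modProb_eq_probFrom _ _ _ _ _ (by omega)]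
      have el : (if c.1 then 1 else τ.compProb (extendHistory h i) l) =
          τ.probFrom (extendHistory h i) (if c.1 then .nil else localShape l) := by
        rcases hl with hl | hl
        · simp [hl, probFrom]
        · split_ifs
          · rfl
          · exact τ.compProb_of_cutFree _ _ hl
      have er : (if c.2 then 1 else τ.compProb (extendHistory h i) r) =
          τ.probFrom (extendHistory h i) (if c.2 then .nil else localShape r) := by
        rcases hr with hr | hr
        · simp [hr, probFrom]
        · split_ifs
          · rfl
          · exact τ.compProb_of_cutFree _ _ hr
      rw [el, er, ← mul_assoc (4 : ℝ)]
      norm_num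
      exact mul_le_of_le_one_left (mul_nonneg (probFrom_nonneg _ _ _) (probFrom_nonneg _ _ _))
        (τ.apply_le_one _ _)
    have hty : nodeType (localShape l) (localShape r) = i := by
      rw [hi, nodeType_eq, nodeType_eq, isNode_localShape, isNode_localShape]
    rcases hu with ⟨hl, hr⟩ | ⟨rfl, ⟨hl, hr⟩ | ⟨hl, hr⟩⟩
    · exact root hl hr
    · by_cases hnil : l = .nil
      · exact root (Or.inr (by rw [hnil]; trivial)) (Or.inr hr)
      obtain ⟨a, e, he, hle⟩ := ihl (extendHistory h i) hl hnil
      refine ⟨a, e + 1, by simp [localShape]; omega, ?_⟩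
      rw [localShape, compProb, ← hi]
      simp only [Bool.false_eq_true, if_false]
      have h0 : ((e + 1 : ℕ) : ℤ) ≠ 0 := by omega
      rw [modProb, if_neg h0, if_neg h0, hty, τ.compProb_of_cutFree _ r hr,
        τ.modProb_eq_probFrom _ _ _ (localShape r) (by push_cast; omega),
        show ((e + 1 : ℕ) : ℤ) - 1 = e by push_cast; ring]
      have := mul_le_mul_of_nonneg_left (mul_le_mul_of_nonneg_right hle
        (τ.probFrom_nonneg (extendHistory h i) (localShape r))) ((τ (kHistory k h)).2.1 i)
      linarith
    · by_cases hnil : r = .nil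
      · exact root (Or.inr hl) (Or.inr (by rw [hnil]; trivial))
      obtain ⟨a, e, he, hle⟩ := ihr (extendHistory h i) hr hnil
      refine ⟨a, e + 1 + (localShape l).numNodes, by simp [localShape]; omega, ?_⟩
      rw [localShape, compProb, ← hi]
      simp only [Bool.false_eq_true, if_false]
      have h0 : ((e + 1 + (localShape l).numNodes : ℕ) : ℤ) ≠ 0 := by omega
      rw [modProb, if_neg h0, if_neg h0, hty, τ.compProb_of_cutFree _ l hl,
        τ.modProb_eq_probFrom _ _ _ (localShape l) (by push_cast; omega),
        show ((e + 1 + (localShape l).numNodes : ℕ) : ℤ) - 1 - (localShape l).numNodes = e by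
          push_cast; ring]
      have := mul_le_mul_of_nonneg_left (mul_le_mul_of_nonneg_left hle
        (τ.probFrom_nonneg (extendHistory h i) (localShape l))) ((τ (kHistory k h)).2.1 i)
      linarith

/-- The probabilities of a shape, added up over all contexts in which it may occur as a micro
tree: the history of its root, the index of the node that owns the portals, and the type of this
node in the whole tree. -/
noncomputable def TypeProcess.contextSum {k : ℕ} (τ : TypeProcess k) (B : ℕ) (s : Shape) : ℝ :=
  ∑ z : List.Vector InnerType k, ∑ a : Fin 4, ∑ e ∈ Finset.range (2 * B),
    τ.modProb a z.toList e s

/-- The number of contexts. -/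
def numContexts (k B : ℕ) : ℕ := 3 ^ k * (4 * (2 * B))

theorem TypeProcess.sum_contextSum_le {k : ℕ} (τ : TypeProcess k) (B : ℕ) (S : Finset Shape)
    (hS : ∀ s ∈ S, s ≠ .nil) : ∑ s ∈ S, τ.contextSum B s ≤ numContexts k B := by
  have h3 : Fintype.card InnerType = 3 := by decide
  simp only [contextSum]
  rw [Finset.sum_comm]
  have : ∀ z : List.Vector InnerType k, ∑ s ∈ S, ∑ a : Fin 4, ∑ e ∈ Finset.range (2 * B),
      τ.modProb a z.toList e s ≤ 4 * (2 * B) := by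
    intro z
    rw [Finset.sum_comm]
    have : ∀ a : Fin 4, ∑ s ∈ S, ∑ e ∈ Finset.range (2 * B),
        τ.modProb a z.toList e s ≤ 2 * B := by
      intro a
      rw [Finset.sum_comm]
      refine (Finset.sum_le_sum fun (e : ℕ) _ =>
        τ.sum_modProb_le_one a z.toList (e : ℤ) S hS).trans ?_
      simp
    refine (Finset.sum_le_sum fun a _ => this a).trans ?_
    simp
  refine (Finset.sum_le_sum fun z _ => this z).trans ?_
  rw [Finset.sum_const, Finset.card_univ, card_vector, h3, numContexts]
  simp

/-- An upper bound for the factor that a micro tree contributes to the probability of the whole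
tree. It is capped at `1`, so that omitting factors does not decrease a product. -/
noncomputable def TypeProcess.share {k : ℕ} (τ : TypeProcess k) (B : ℕ) (s : Shape) : ℝ :=
  min 1 (4 * τ.contextSum B s)

theorem TypeProcess.contextSum_nonneg {k : ℕ} (τ : TypeProcess k) (B : ℕ) (s : Shape) :
    0 ≤ τ.contextSum B s :=
  Finset.sum_nonneg fun _ _ => Finset.sum_nonneg fun _ _ => Finset.sum_nonneg fun _ _ =>
    τ.modProb_nonneg _ _ _ _

theorem TypeProcess.share_nonneg {k : ℕ} (τ : TypeProcess k) (B : ℕ) (s : Shape) :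
    0 ≤ τ.share B s :=
  le_min zero_le_one (mul_nonneg (by norm_num) (τ.contextSum_nonneg B s))

theorem TypeProcess.compProb_le_share {k : ℕ} (τ : TypeProcess k) (B : ℕ) (h : List InnerType)
    (u : BinaryTree (Bool × Bool)) (hu : SinglePortalNode u) (hne : u ≠ .nil)
    (hB : (localShape u).numNodes < 2 * B) : τ.compProb h u ≤ τ.share B (localShape u) := by
  refine le_min (τ.compProb_le_one h u) ?_
  obtain ⟨a, e, he, hle⟩ := τ.exists_compProb_le_modProb h u hu hne
  refine hle.trans (mul_le_mul_of_nonneg_left ?_ (by norm_num))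
  rw [τ.modProb_congr a h (kHistory k h).toList fun g => (kHistory_toList_append k h g).symm]
  refine le_trans ?_ (Finset.single_le_sum (fun z _ => ?_) (Finset.mem_univ (kHistory k h)))
  · refine le_trans ?_ (Finset.single_le_sum (fun a _ => ?_) (Finset.mem_univ a))
    · exact Finset.single_le_sum (f := fun e : ℕ => τ.modProb a (kHistory k h).toList e _)
        (fun e _ => τ.modProb_nonneg _ _ _ _) (Finset.mem_range.2 (he.trans hB))
    · exact Finset.sum_nonneg fun _ _ => τ.modProb_nonneg _ _ _ _
  · exact Finset.sum_nonneg fun _ _ => Finset.sum_nonneg fun _ _ => τ.modProb_nonneg _ _ _ _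

/-- The product of the shares of the micro trees in a top tier. -/
noncomputable def TypeProcess.tierShare {k : ℕ} (τ : TypeProcess k) (B : ℕ)
    (U : BinaryTree MicroTree) : ℝ :=
  ((preorder U).map fun M => τ.share B M.shape).prod

theorem list_prod_map_mem_unitInterval {α : Type*} (f : α → ℝ) (l : List α)
    (hf : ∀ x ∈ l, f x ∈ Set.Icc (0 : ℝ) 1) : (l.map f).prod ∈ Set.Icc (0 : ℝ) 1 := by
  induction l with
  | nil => simp
  | cons x l ih =>
    rw [List.forall_mem_cons] at hf
    have := ih hf.2
    rw [List.map_cons, List.prod_cons]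
    exact ⟨mul_nonneg hf.1.1 this.1, mul_le_one₀ hf.1.2 this.1 this.2⟩

theorem list_prod_map_le_of_mem {α : Type*} (f : α → ℝ) (l : List α)
    (hf : ∀ x ∈ l, f x ∈ Set.Icc (0 : ℝ) 1) {x : α} (hx : x ∈ l) : (l.map f).prod ≤ f x := by
  induction l with
  | nil => simp at hx
  | cons y l ih =>
    rw [List.forall_mem_cons] at hf
    have := list_prod_map_mem_unitInterval f l hf.2
    rw [List.map_cons, List.prod_cons]
    rcases List.mem_cons.1 hx with rfl | hx
    · exact mul_le_of_le_one_right hf.1.1 this.2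
    · exact (mul_le_of_le_one_left this.1 hf.1.2).trans (ih hf.2 hx)

theorem TypeProcess.tierShare_mem {k : ℕ} (τ : TypeProcess k) (B : ℕ)
    (U : BinaryTree MicroTree) : τ.tierShare B U ∈ Set.Icc (0 : ℝ) 1 :=
  list_prod_map_mem_unitInterval _ _ fun _ _ => ⟨τ.share_nonneg _ _, min_le_left _ _⟩

/-- The probability of a tree is bounded by the shares of its micro trees. In the second part the
component of the root enters with its exact contribution, which makes the bound multiplicative as
long as this component grows. -/
theorem TypeProcess.probFrom_le_tierShare_contract {k : ℕ} (τ : TypeProcess k) {B : ℕ}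
    (u : BinaryTree (Bool × Bool)) (hu : GoodCover B u) (h : List InnerType) :
    τ.probFrom h (skeleton u) ≤ τ.tierShare B (contract u).1 ∧
      τ.probFrom h (skeleton u) ≤
        τ.compProb h u * ((contract u).2.map (τ.tierShare B)).prod := by
  induction u generalizing h with
  | nil => simp [contract, skeleton, BinaryTree.map, probFrom, compProb, tierShare, preorder]
  | node c l r ihl ihr =>
    obtain ⟨hp, hs, hl, hr⟩ := hu
    have hcomp := τ.compProb_le_share B h _ hp (by simp) hs
    set i := nodeType (skeleton l) (skeleton r) with hi
    set ps := if c.1 then [(contract l).1] else (contract l).2 with hps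
    set qs := if c.2 then [(contract r).1] else (contract r).2 with hqs
    have hmem : ∀ xs : List (BinaryTree MicroTree), ∀ v ∈ xs,
        τ.tierShare B v ∈ Set.Icc (0 : ℝ) 1 := fun _ v _ => τ.tierShare_mem B v
    have hl' : τ.probFrom (extendHistory h i) (skeleton l) ≤
        (if c.1 then 1 else τ.compProb (extendHistory h i) l) *
          (ps.map (τ.tierShare B)).prod := by
      rw [hps]
      split_ifs
      · simpa using (ihl hl (extendHistory h i)).1
      · exact (ihl hl (extendHistory h i)).2
    have hr' : τ.probFrom (extendHistory h i) (skeleton r) ≤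
        (if c.2 then 1 else τ.compProb (extendHistory h i) r) *
          (qs.map (τ.tierShare B)).prod := by
      rw [hqs]
      split_ifs
      · simpa using (ihr hr (extendHistory h i)).1
      · exact (ihr hr (extendHistory h i)).2
    have main : τ.probFrom h (skeleton (.node c l r)) ≤
        τ.compProb h (.node c l r) * ((ps ++ qs).map (τ.tierShare B)).prod := by
      have := mul_le_mul hl' hr' (τ.probFrom_nonneg _ _)
        (le_trans (τ.probFrom_nonneg _ _) hl')
      have := mul_le_mul_of_nonneg_left this ((τ (kHistory k h)).2.1 i)
      rw [List.map_append, List.prod_append]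
      change (τ (kHistory k h)).1 i * _ ≤ (τ (kHistory k h)).1 i * _ * _
      refine this.trans (le_of_eq ?_)
      ring
    -- subtrees other than the first portal target may be dropped, since shares are at most `1`
    have htarget : ∀ xs : List (BinaryTree MicroTree),
        (xs.map (τ.tierShare B)).prod ≤ τ.tierShare B (portalTarget xs) := by
      intro xs
      rw [portalTarget]
      cases hx : xs.find? isNode with
      | none => simpa [tierShare, preorder] using
          (list_prod_map_mem_unitInterval (τ.tierShare B) xs (hmem xs)).2
      | some v => exact list_prod_map_le_of_mem _ xs (hmem xs) (List.mem_of_find?_eq_some hx)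
    refine ⟨main.trans ?_, by rw [contract]; exact main⟩
    have hcons : τ.tierShare B (contract (.node c l r)).1 =
        τ.share B (localShape (.node c l r)) *
          (τ.tierShare B (portalTarget ps) * τ.tierShare B (portalTarget qs)) := by
      rw [contract]
      simp [tierShare, preorder, hps, hqs]
    rw [hcons, List.map_append, List.prod_append]
    refine mul_le_mul hcomp (mul_le_mul (htarget ps) (htarget qs) ?_ ?_) ?_ ?_
    · exact (list_prod_map_mem_unitInterval _ qs (hmem qs)).1
    · exact (τ.tierShare_mem B _).1
    · exact mul_nonneg (list_prod_map_mem_unitInterval _ ps (hmem ps)).1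
        (list_prod_map_mem_unitInterval _ qs (hmem qs)).1
    · exact τ.share_nonneg _ _

theorem TypeProcess.prob_le_tierShare {k : ℕ} (τ : TypeProcess k) {B : ℕ} (hB : 1 ≤ B)
    (t : Shape) : τ.prob t ≤ τ.tierShare B (topTier B t) := by
  rw [τ.prob_eq_probFrom]
  conv_lhs => rw [← skeleton_farzanMunro B t]
  exact (τ.probFrom_le_tierShare_contract _ (goodCover_farzanMunro hB t) []).1

/-- The Huffman code for the micro trees is no longer than the Shannon code for the probabilities
`contextSum / numContexts`. -/
theorem TypeProcess.sum_length_huffman_le {k : ℕ} (τ : TypeProcess k) {B : ℕ} (hB : 1 ≤ B)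
    (t : Shape) (hτ : 0 < τ.prob t) (C : Shape → List Bool)
    (hC : IsHuffmanCode ((preorder (topTier B t)).map MicroTree.shape) C) :
    ((((preorder (topTier B t)).map MicroTree.shape).map fun s => (C s).length).sum : ℝ) ≤
      Real.logb 2 (1 / τ.prob t) +
        (preorder (topTier B t)).length * (Real.logb 2 (numContexts k B) + 3) := by
  set L := preorder (topTier B t) with hL
  set K : ℝ := (numContexts k B : ℝ) with hK
  have hK0 : 0 < K := by
    rw [hK, numContexts]
    exact_mod_cast (by positivity)
  have hprod : τ.prob t ≤ (L.map fun M => τ.share B M.shape).prod := τ.prob_le_tierShare hB t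
  have hshare : ∀ M ∈ L, 0 < τ.share B M.shape := by
    intro M hM
    exact (hτ.trans_le hprod).trans_le (list_prod_map_le_of_mem
      (fun M : MicroTree => τ.share B M.shape) L
      (fun M _ => ⟨τ.share_nonneg _ _, min_le_left _ _⟩) hM)
  have hctx : ∀ M ∈ L, 0 < τ.contextSum B M.shape := by
    intro M hM
    have := (hshare M hM).trans_le (min_le_right _ _)
    linarith
  have hne : ∀ s ∈ (L.map MicroTree.shape).toFinset, s ≠ .nil := by
    intro s hs
    rw [List.mem_toFinset, List.mem_map] at hs
    obtain ⟨M, hM, rfl⟩ := hs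
    exact ((forall_mem_preorder_contract _ (goodCover_farzanMunro hB t)).1 M hM).1
  let len : Shape → ℕ := fun s => ⌈Real.logb 2 (K / τ.contextSum B s)⌉₊
  have hkraft : ∑ s ∈ (L.map MicroTree.shape).toFinset, (1 / 2 : ℝ) ^ len s ≤ 1 := by
    have : ∀ s ∈ (L.map MicroTree.shape).toFinset,
        (1 / 2 : ℝ) ^ len s ≤ τ.contextSum B s / K := by
      intro s hs
      rw [List.mem_toFinset, List.mem_map] at hs
      obtain ⟨M, hM, rfl⟩ := hs
      have hpos := hctx M hM
      have h1 : K / τ.contextSum B M.shape ≤ 2 ^ (len M.shape) := by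
        rw [← Real.rpow_natCast, ← Real.logb_le_iff_le_rpow (by norm_num) (by positivity)]
        exact Nat.le_ceil _
      rw [one_div, inv_pow, ← inv_div]
      exact inv_anti₀ (by positivity) h1
    refine (Finset.sum_le_sum this).trans ?_
    rw [← Finset.sum_div, div_le_one hK0]
    exact τ.sum_contextSum_le B _ hne
  have hopt := hC.sum_length_le len hkraft
  have hopt' : ((((L.map MicroTree.shape).map fun s => (C s).length).sum : ℕ) : ℝ) ≤
      (((L.map MicroTree.shape).map len).sum : ℕ) := by exact_mod_cast hopt
  refine hopt'.trans ?_
  have hterm : ∀ M ∈ L, (len M.shape : ℝ) ≤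
      (Real.logb 2 K + 3) - Real.logb 2 (τ.share B M.shape) := by
    intro M hM
    have hc := hctx M hM
    have hs := hshare M hM
    have h4 : Real.logb 2 (τ.share B M.shape) ≤ 2 + Real.logb 2 (τ.contextSum B M.shape) := by
      have : Real.logb 2 (4 * τ.contextSum B M.shape) =
          2 + Real.logb 2 (τ.contextSum B M.shape) := by
        rw [Real.logb_mul (by norm_num) hc.ne', show (4 : ℝ) = 2 ^ (2 : ℝ) by norm_num,
          Real.logb_rpow (by norm_num) (by norm_num)]
      rw [← this]
      exact Real.logb_le_logb_of_le (by norm_num) hs (min_le_right _ _)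
    rcases le_or_gt 0 (Real.logb 2 (K / τ.contextSum B M.shape)) with h0 | h0
    · have h5 := (Nat.ceil_lt_add_one h0).le
      rw [Real.logb_div hK0.ne' hc.ne'] at h5
      change ((⌈_⌉₊ : ℕ) : ℝ) ≤ _
      rw [Real.logb_div hK0.ne' hc.ne']
      linarith
    · have : len M.shape = 0 := Nat.ceil_eq_zero.2 h0.le
      rw [this]
      have h6 : Real.logb 2 (τ.share B M.shape) ≤ 0 :=
        Real.logb_nonpos (by norm_num) hs.le (min_le_left _ _)
      have h7 : 0 ≤ Real.logb 2 K := Real.logb_nonneg (by norm_num) (by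
        rw [hK, numContexts]
        exact_mod_cast Nat.one_le_iff_ne_zero.2 (by positivity))
      push_cast
      linarith
  have hsum : ∀ l : List MicroTree, (∀ M ∈ l, M ∈ L) →
      ((((l.map MicroTree.shape).map len).sum : ℕ) : ℝ) ≤
        l.length * (Real.logb 2 K + 3) -
          Real.logb 2 (l.map fun M => τ.share B M.shape).prod ∧
      0 < (l.map fun M => τ.share B M.shape).prod := by
    intro l hl
    induction l with
    | nil => simp
    | cons M l ih =>
      rw [List.forall_mem_cons] at hl
      obtain ⟨h1, h2⟩ := ih hl.2
      have h3 := hterm M hl.1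
      have h4 := hshare M hl.1
      simp only [List.map_cons, List.sum_cons, List.prod_cons, List.length_cons]
      rw [Real.logb_mul h4.ne' h2.ne']
      push_cast at h1 ⊢
      exact ⟨by linarith, mul_pos h4 h2⟩
  have h1 := (hsum L fun _ h => h).1
  have h2 := Real.logb_le_logb_of_le (b := 2) (by norm_num) hτ hprod
  rw [one_div, Real.logb_inv]
  linarith

/-! ### The length of the code -/

theorem length_gamma_le (n : ℕ) : (gamma n).length ≤ 2 * Nat.log 2 n + 1 := by
  have : n.size ≤ Nat.log 2 n + 1 := Nat.size_le.2 (Nat.lt_pow_succ_log_self (by norm_num) n)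
  rw [gamma, List.length_append, List.length_replicate, List.length_reverse,
    Nat.size_eq_bits_len]
  omega

theorem length_bp {α : Type*} (t : BinaryTree α) : (bp t).length = 2 * t.numNodes := by
  induction t with
  | nil => rfl
  | node _ l r ihl ihr => simp [bp, ihl, ihr]; ring

theorem length_preorder {α : Type*} (t : BinaryTree α) : (preorder t).length = t.numNodes := by
  induction t with
  | nil => rfl
  | node _ l r ihl ihr => simp [preorder, ihl, ihr]

/-- The restricted code uses the alternative codeword only if it has at most `|C s| + 1` bits. -/
theorem length_restrict_le_succ (C : Shape → List Bool) (s : Shape) :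
    (restrict C s).length ≤ (C s).length + 1 := by
  have := length_gamma_le (s.numNodes + 1)
  rw [restrict]
  split_ifs with h
  · rw [List.length_cons, List.length_append, length_bp]
    omega
  · simp

theorem length_restrict_le (C : Shape → List Bool) (s : Shape) :
    (restrict C s).length ≤ 4 * s.numNodes + 2 := by
  have h1 := length_gamma_le (s.numNodes + 1)
  have h2 : Nat.log 2 (s.numNodes + 1) < s.numNodes + 1 := Nat.log_lt_self 2 (by omega)
  rw [restrict]
  split_ifs with h
  · rw [List.length_cons, List.length_append, length_bp]
    omega
  · rw [List.length_cons]
    omega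

theorem length_tableEntry_le (C : Shape → List Bool) (s : Shape) :
    (gamma (restrict C s).length ++ restrict C s ++ gamma s.numNodes ++ bp s).length ≤
      16 * s.numNodes + 8 := by
  have h1 := length_restrict_le C s
  have h2 := length_gamma_le (restrict C s).length
  have h3 := length_gamma_le s.numNodes
  have h4 := Nat.log_le_self 2 (restrict C s).length
  have h5 := Nat.log_le_self 2 s.numNodes
  simp only [List.length_append, length_bp]
  omega

theorem length_flatMap_le {α β : Type*} (l : List α) (f : α → List β) (c : ℕ)
    (hf : ∀ a ∈ l, (f a).length ≤ c) : (l.flatMap f).length ≤ l.length * c := by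
  rw [List.length_flatMap]
  simpa using List.sum_le_card_nsmul (l.map fun a => (f a).length) c (by simpa using hf)

theorem length_encode_le (w n S : ℕ) (U : BinaryTree MicroTree) (C : Shape → List Bool)
    (hS : ∀ M ∈ preorder U, M.shape.numNodes ≤ S) :
    (encode w n U C).length ≤
      2 * Nat.log 2 n + 2 * Nat.log 2 U.numNodes + 3 + U.numNodes * (3 + 2 * w) +
        ((preorder U).map MicroTree.shape).toFinset.card * (16 * S + 10) +
        (((preorder U).map MicroTree.shape).map fun s => (C s).length).sum := by
  have hn := length_gamma_le n
  have hm := length_gamma_le U.numNodes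
  rw [List.card_toFinset]
  set A := ((preorder U).map MicroTree.shape).dedup with hA
  have hN := length_gamma_le A.length
  have hN' := Nat.log_le_self 2 A.length
  have htable := length_flatMap_le A (fun s =>
    gamma (restrict C s).length ++ restrict C s ++ gamma s.numNodes ++ bp s) (16 * S + 8) (by
      intro s hs
      rw [hA, List.mem_dedup, List.mem_map] at hs
      obtain ⟨M, hM, rfl⟩ := hs
      have := hS M hM
      have := length_tableEntry_le C M.shape
      omega)
  have hcode : (((preorder U).map MicroTree.shape).flatMap (restrict C)).length ≤
      (((preorder U).map MicroTree.shape).map fun s => (C s).length).sum + U.numNodes := by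
    rw [List.length_flatMap]
    refine (List.sum_le_sum fun s _ => length_restrict_le_succ C s).trans ?_
    rw [List.sum_map_add]
    simp [length_preorder, Function.comp_def]
  have hportal : ((preorder U).flatMap fun M =>
      fixedWidth w M.leftPortal ++ fixedWidth w M.rightPortal).length ≤
        U.numNodes * (2 * w) := by
    rw [← length_preorder U]
    refine length_flatMap_le _ _ _ fun M _ => ?_
    simp [fixedWidth]
    omega
  rw [encode]
  simp only [← hA]
  simp only [List.length_append, length_bp] at htable hportal ⊢
  rw [mul_add] at htable
  rw [mul_add, mul_add]
  omega

/-! ### Asymptotics -/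

/-- This is `lg z ≤ z` for the fourth root `z` of `n`. -/
theorem sq_logb_le_sqrt {n : ℝ} (hn : 1 ≤ n) : Real.logb 2 n ^ 2 ≤ 16 * √n := by
  have hq : (1 : ℝ) ≤ √(√n) := Real.one_le_sqrt.2 (Real.one_le_sqrt.2 hn)
  have hle : Real.logb 2 √(√n) ≤ √(√n) := by
    rw [Real.logb_le_iff_le_rpow (by norm_num) (by linarith)]
    have := one_add_mul_self_le_rpow_one_add (s := 1) (by norm_num) hq
    norm_num at this
    linarith
  have hs : √(√n) ^ 2 = √n := Real.sq_sqrt (Real.sqrt_nonneg n)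
  have hn4 : n = √(√n) ^ 4 := by
    rw [show 4 = 2 * 2 from rfl, pow_mul, hs, Real.sq_sqrt (by linarith)]
  have h0 : 0 ≤ Real.logb 2 √(√n) := Real.logb_nonneg (by norm_num) hq
  have hlog : Real.logb 2 n = 4 * Real.logb 2 √(√n) := by
    conv_lhs => rw [hn4, Real.logb_pow]
    norm_num
  have := pow_le_pow_left₀ h0 hle 2
  rw [hlog, mul_pow]
  linarith

/-- The lower-order terms: `n` is the size of the tree, `x = lg n`, `y = lg lg n`, `m` is the
number of micro trees and `N` the number of their shapes. The constant is
`32 * 29 + 2 * 16 * (9 + 16 * 39)`: the first summand bounds the term with `m`, and the second one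
all other terms, which are at most `(9 + 16 * 39) * √n * x`, hence at most
`16 * (9 + 16 * 39) * n / x`, where `1 ≤ 2 * y`. -/
theorem lower_order_terms_le {n x y m N k : ℝ} (hn : 1 ≤ n) (hk : 0 ≤ k) (hx : 3 / 2 ≤ x)
    (hy : 1 / 2 ≤ y) (hm0 : 0 ≤ m) (hm : m * x ≤ 32 * n) (hN : N ≤ 16 * √n)
    (hxn : x ^ 2 ≤ 16 * √n) :
    4 * x + 7 + N * (32 * x + 10) + m * (2 * k + 3 * y + 13) ≤
      21184 * ((n * k + n * y) / x) := by
  have hs1 : 1 ≤ √n := Real.one_le_sqrt.2 hn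
  have hsn : √n * √n = n := Real.mul_self_sqrt (by linarith)
  have h1 : N * (32 * x + 10) ≤ 16 * √n * (39 * x) :=
    mul_le_mul hN (by linarith) (by linarith) (by linarith)
  have h2 : 4 * x + 7 ≤ √n * (9 * x) := by nlinarith
  have h3 : m * (2 * k + 3 * y + 13) ≤ m * (29 * (k + y)) :=
    mul_le_mul_of_nonneg_left (by linarith) hm0
  have hx0 : 0 < x := by linarith
  rw [mul_div_assoc', le_div_iff₀ hx0]
  have h4 : m * (29 * (k + y)) * x ≤ 32 * n * (29 * (k + y)) := by
    have := mul_le_mul_of_nonneg_right hm (show 0 ≤ 29 * (k + y) by linarith)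
    linarith
  have h5 : √n * x * x ≤ 16 * n := by
    have := mul_le_mul_of_nonneg_left hxn (Real.sqrt_nonneg n)
    nlinarith
  have h6 : (4 * x + 7 + N * (32 * x + 10) + m * (2 * k + 3 * y + 13)) * x ≤
      (√n * (9 * x) + 16 * √n * (39 * x) + m * (29 * (k + y))) * x :=
    mul_le_mul_of_nonneg_right (by linarith) hx0.le
  have h7 : n ≤ 2 * (n * y) := by nlinarith
  have h8 : 0 ≤ n * k := mul_nonneg (by linarith) hk
  nlinarith

theorem logb_two_bounds {n : ℕ} (hn : 3 ≤ n) :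
    3 / 2 ≤ Real.logb 2 n ∧ 1 / 2 ≤ Real.logb 2 (Real.logb 2 n) := by
  have h3 : (3 : ℝ) ≤ n := by exact_mod_cast hn
  have hx : 3 / 2 ≤ Real.logb 2 n := by
    rw [Real.le_logb_iff_rpow_le (by norm_num) (by linarith)]
    have h : ((2 : ℝ) ^ (3 / 2 : ℝ)) ^ 2 = 8 := by
      rw [← Real.rpow_natCast, ← Real.rpow_mul (by norm_num)]
      norm_num
    have : ((2 : ℝ) ^ (3 / 2 : ℝ)) ≤ 3 := abs_le_of_sq_le_sq' (by rw [h]; norm_num)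
      (by norm_num) |>.2
    linarith
  refine ⟨hx, ?_⟩
  rw [Real.le_logb_iff_rpow_le (by norm_num) (by linarith)]
  have h : ((2 : ℝ) ^ (1 / 2 : ℝ)) ^ 2 = 2 := by
    rw [← Real.rpow_natCast, ← Real.rpow_mul (by norm_num)]
    norm_num
  have : ((2 : ℝ) ^ (1 / 2 : ℝ)) ≤ 3 / 2 := abs_le_of_sq_le_sq' (by rw [h]; norm_num)
    (by norm_num) |>.2
  linarith

theorem one_le_coverParam {n : ℕ} (hn : 3 ≤ n) : 1 ≤ coverParam n :=
  Nat.one_le_ceil_iff.2 (by have := (logb_two_bounds hn).1; linarith)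

theorem coverParam_le {n : ℕ} (hn : 3 ≤ n) :
    (coverParam n : ℝ) ≤ Real.logb 2 n / 8 + 1 :=
  (Nat.ceil_lt_add_one (by have := (logb_two_bounds hn).1; linarith)).le

theorem logb_le_self {n : ℕ} (hn : 1 ≤ n) : Real.logb 2 n ≤ n := by
  rw [Real.logb_le_iff_le_rpow (by norm_num) (by exact_mod_cast hn), Real.rpow_natCast]
  exact_mod_cast Nat.lt_two_pow_self.le

theorem coverParam_le_self {n : ℕ} (hn : 3 ≤ n) : coverParam n ≤ n := by
  have h1 := coverParam_le hn
  have h2 := logb_le_self (n := n) (by omega)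
  have h3 : (3 : ℝ) ≤ n := by exact_mod_cast hn
  have : (coverParam n : ℝ) ≤ n := by linarith
  exact_mod_cast this

theorem four_pow_coverParam_le {n : ℕ} (hn : 3 ≤ n) :
    (4 : ℝ) ^ (2 * coverParam n) ≤ 16 * √n := by
  have h1 := coverParam_le hn
  have hn0 : (0 : ℝ) < n := by exact_mod_cast (by omega : 0 < n)
  have h2 : (4 : ℝ) ^ (2 * coverParam n) = 2 ^ (4 * coverParam n : ℝ) := by
    rw [show (4 * coverParam n : ℝ) = ((4 * coverParam n : ℕ) : ℝ) by push_cast; ring,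
      Real.rpow_natCast, show (4 : ℝ) = 2 ^ 2 by norm_num, ← pow_mul]
    congr 1
    ring
  have h3 : √(n : ℝ) = 2 ^ (Real.logb 2 n * (1 / 2)) := by
    rw [Real.rpow_mul (by norm_num), Real.rpow_logb (by norm_num) (by norm_num) hn0,
      Real.sqrt_eq_rpow]
  rw [h2, h3, show (16 : ℝ) = 2 ^ (4 : ℝ) by norm_num, ← Real.rpow_add (by norm_num)]
  exact Real.rpow_le_rpow_of_exponent_le (by norm_num) (by linarith)

theorem clog_microBound_le {n : ℕ} (hn : 3 ≤ n) :
    (Nat.clog 2 (microBound n + 1) : ℝ) ≤ Real.logb 2 (Real.logb 2 n) + 2 := by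
  obtain ⟨hx, -⟩ := logb_two_bounds hn
  have h1 : (microBound n : ℝ) ≤ Real.logb 2 n / 4 + 1 :=
    (Nat.ceil_lt_add_one (by linarith)).le
  have h2 : Real.logb 2 (microBound n + 1 : ℕ) ≤ 1 + Real.logb 2 (Real.logb 2 n) := by
    have : (1 : ℝ) = Real.logb 2 2 := (Real.logb_self_eq_one (by norm_num)).symm
    rw [this, ← Real.logb_mul (by norm_num) (by linarith)]
    refine Real.logb_le_logb_of_le (by norm_num) (by positivity) ?_
    push_cast
    linarith
  have h3 := Real.natCeil_logb_natCast 2 (microBound n + 1)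
  rw [Nat.cast_ofNat] at h3
  rw [← h3]
  have h4 := Nat.ceil_lt_add_one (a := Real.logb 2 (microBound n + 1 : ℕ))
    (Real.logb_nonneg (by norm_num)
      (by push_cast; linarith [Nat.cast_nonneg (α := ℝ) (microBound n)]))
  linarith

theorem logb_numContexts_le {n : ℕ} (hn : 3 ≤ n) (k : ℕ) :
    Real.logb 2 (numContexts k (coverParam n)) ≤ 2 * k + 3 + Real.logb 2 (Real.logb 2 n) := by
  obtain ⟨hx, -⟩ := logb_two_bounds hn
  have hB : (0 : ℝ) < coverParam n := by exact_mod_cast one_le_coverParam hn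
  have h1 := coverParam_le hn
  have h3 : Real.logb 2 3 ≤ 2 := by
    rw [Real.logb_le_iff_le_rpow (by norm_num) (by norm_num)]
    norm_num
  have h8 : Real.logb 2 8 = 3 := by
    rw [show (8 : ℝ) = 2 ^ (3 : ℝ) by norm_num, Real.logb_rpow (by norm_num) (by norm_num)]
  have hlog : Real.logb 2 (coverParam n) ≤ Real.logb 2 (Real.logb 2 n) :=
    Real.logb_le_logb_of_le (by norm_num) hB (by linarith)
  have : (numContexts k (coverParam n) : ℝ) = 3 ^ k * (8 * coverParam n) := by
    rw [numContexts]
    push_cast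
    ring
  rw [this, Real.logb_mul (by positivity) (by positivity), Real.logb_pow,
    Real.logb_mul (by norm_num) hB.ne', h8]
  have := mul_le_mul_of_nonneg_left h3 (Nat.cast_nonneg (α := ℝ) k)
  linarith

/-- The first inequality, from which the second one follows for the empirical process. -/
theorem length_le_of_typeProcess {H : Shape → List Bool} (hH : IsHypersuccinctCode H) (k : ℕ)
    (t : Shape) (hn : 3 ≤ t.numNodes) (τ : TypeProcess k) (hτ : 0 < τ.prob t) :
    ((H t).length : ℝ) ≤ Real.logb 2 (1 / τ.prob t) +
      21184 * ((t.numNodes * k + t.numNodes * Real.logb 2 (Real.logb 2 t.numNodes)) /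
        Real.logb 2 t.numNodes) := by
  obtain ⟨C, hC, hHt⟩ := hH t
  obtain ⟨hx, hy⟩ := logb_two_bounds hn
  have hB1 := one_le_coverParam hn
  have hgood := (forall_mem_preorder_contract _
    (goodCover_farzanMunro hB1 t)).1
  have henc := length_encode_le (Nat.clog 2 (microBound t.numNodes + 1)) t.numNodes
    (2 * coverParam t.numNodes) (tier t) C fun M hM => (hgood M hM).2.le
  have hhuff := τ.sum_length_huffman_le hB1 t hτ C hC
  have hm := mul_numNodes_topTier_le hB1 t (coverParam_le_self hn)
  have hcard := card_shapes_le ((preorder (tier t)).map MicroTree.shape).toFinset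
    (2 * coverParam t.numNodes)
    (by
      intro s hs
      rw [List.mem_toFinset, List.mem_map] at hs
      obtain ⟨M, hM, rfl⟩ := hs
      exact (hgood M hM).1)
    (by
      intro s hs
      rw [List.mem_toFinset, List.mem_map] at hs
      obtain ⟨M, hM, rfl⟩ := hs
      exact (hgood M hM).2.le)
  rw [← hHt] at henc
  change coverParam t.numNodes * (tier t).numNodes ≤ _ at hm
  change (((((preorder (tier t)).map MicroTree.shape).map fun s => (C s).length).sum : ℕ) : ℝ) ≤
    _ + ((preorder (tier t)).length : ℝ) * _ at hhuff
  rw [length_preorder] at hhuff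
  set n := t.numNodes with hn_def
  set m := (tier t).numNodes with hm_def
  set N := ((preorder (tier t)).map MicroTree.shape).toFinset.card with hN_def
  set L := (((preorder (tier t)).map MicroTree.shape).map fun s => (C s).length).sum
  set w := Nat.clog 2 (microBound n + 1)
  have hw : (w : ℝ) ≤ _ := clog_microBound_le hn
  have hK := logb_numContexts_le hn k
  have hBle := coverParam_le hn
  have hBge : Real.logb 2 n / 8 ≤ coverParam n := Nat.le_ceil _
  set x := Real.logb 2 n with hx_def
  set y := Real.logb 2 x with hy_def
  have hlogn : (Nat.log 2 n : ℝ) ≤ x := Real.natLog_le_logb n 2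
  have hlogm : (Nat.log 2 m : ℝ) ≤ x + 2 := by
    have h1 : m ≤ 2 ^ 2 * n := by nlinarith
    have h2 : Nat.log 2 m ≤ Nat.log 2 n + 2 := by
      refine (Nat.log_mono_right h1).trans (le_of_eq ?_)
      rw [show 2 ^ 2 * n = n * 2 * 2 by ring, Nat.log_mul_base (by norm_num) (by omega),
        Nat.log_mul_base (by norm_num) (by omega)]
    have : (Nat.log 2 m : ℝ) ≤ Nat.log 2 n + 2 := by exact_mod_cast h2
    linarith
  have hmr : (m : ℝ) * x ≤ 32 * n := by
    have h1 : (coverParam n : ℝ) * m ≤ 4 * n := by exact_mod_cast hm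
    have := mul_le_mul_of_nonneg_right hBge (Nat.cast_nonneg (α := ℝ) m)
    linarith
  have hNr : (N : ℝ) ≤ 16 * √n := by
    refine le_trans ?_ (four_pow_coverParam_le hn)
    exact_mod_cast hcard
  have hlow := lower_order_terms_le (n := n) (x := x) (y := y) (m := m) (N := N) (k := k)
    (by exact_mod_cast (by omega : 1 ≤ n)) (Nat.cast_nonneg _) hx hy (Nat.cast_nonneg _) hmr hNr
    (sq_logb_le_sqrt (by exact_mod_cast (by omega : 1 ≤ n)))
  refine le_trans ?_ (add_le_add_right hlow _)
  have henc' : ((H t).length : ℝ) ≤ 2 * Nat.log 2 n + 2 * Nat.log 2 m + 3 + m * (3 + 2 * w) +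
      N * (16 * (2 * coverParam n) + 10) + L := by exact_mod_cast henc
  have h1 : (m : ℝ) * (3 + 2 * w) ≤ m * (3 + 2 * (y + 2)) :=
    mul_le_mul_of_nonneg_left (by linarith) (Nat.cast_nonneg _)
  have h2 : (N : ℝ) * (16 * (2 * coverParam n) + 10) ≤ N * (32 * x + 10) :=
    mul_le_mul_of_nonneg_left (by linarith) (Nat.cast_nonneg _)
  have h3 : (m : ℝ) * (Real.logb 2 (numContexts k (coverParam n)) + 3) ≤
      m * (2 * k + 3 + y + 3) :=
    mul_le_mul_of_nonneg_left (by linarith) (Nat.cast_nonneg _)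
  linarith

/-! ### The empirical type process -/

theorem sum_count_prodMk {α β : Type*} [DecidableEq α] [DecidableEq β] [Fintype β]
    (l : List (α × β)) (a : α) : ∑ b, l.count (a, b) = (l.map Prod.fst).count a := by
  induction l with
  | nil => simp
  | cons p l ih =>
    obtain ⟨a', b'⟩ := p
    simp only [List.count_cons, Finset.sum_add_distrib, ih, List.map_cons, beq_iff_eq,
      Prod.mk.injEq]
    by_cases h : a' = a <;> simp [h]

/-- The empirical type process of `t`: the relative frequencies of the types after each history
that occurs in `t`, and the point mass at `0` after all other histories. -/
noncomputable def empiricalProcess (k : ℕ) (t : Shape) : TypeProcess k := fun z =>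
  if h : historyCount t z = 0 then ⟨Pi.single 0 1, single_mem_stdSimplex ℝ 0⟩
  else ⟨fun i => typeCount t z i / historyCount t z, fun i => by positivity, by
    have hsum : ∑ i, typeCount t z i = historyCount t z := by
      exact sum_count_prodMk (typedNodes k t) z
    rw [← Finset.sum_div, div_eq_one_iff_eq (by exact_mod_cast h)]
    exact_mod_cast hsum⟩

theorem logb_list_prod (b : ℝ) (l : List ℝ) (hl : ∀ a ∈ l, a ≠ 0) :
    Real.logb b l.prod = (l.map (Real.logb b)).sum := by
  induction l with
  | nil => simp
  | cons a l ih =>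
    rw [List.forall_mem_cons] at hl
    rw [List.prod_cons, Real.logb_mul hl.1 (List.prod_ne_zero fun h => hl.2 0 h rfl), ih hl.2,
      List.map_cons, List.sum_cons]

theorem empiricalProcess_apply {k : ℕ} {t : Shape} {p : List.Vector InnerType k × Fin 4}
    (hp : p ∈ typedNodes k t) :
    (empiricalProcess k t p.1).1 p.2 = typeCount t p.1 p.2 / historyCount t p.1 ∧
      0 < typeCount t p.1 p.2 ∧ 0 < historyCount t p.1 := by
  have h1 : 0 < typeCount t p.1 p.2 := List.count_pos_iff.2 hp
  have h2 : 0 < historyCount t p.1 :=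
    List.count_pos_iff.2 (List.mem_map_of_mem (f := Prod.fst) hp)
  refine ⟨?_, h1, h2⟩
  rw [empiricalProcess, dif_neg h2.ne']

theorem prob_empiricalProcess_pos (k : ℕ) (t : Shape) : 0 < (empiricalProcess k t).prob t := by
  refine List.prod_pos fun a ha => ?_
  obtain ⟨p, hp, rfl⟩ := List.mem_map.1 ha
  obtain ⟨h, h1, h2⟩ := empiricalProcess_apply hp
  rw [h]
  positivity

theorem logb_prob_empiricalProcess (k : ℕ) (t : Shape) :
    Real.logb 2 (1 / (empiricalProcess k t).prob t) = typeEntropy k t := by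
  have hne : ∀ a ∈ (typedNodes k t).map fun p => (empiricalProcess k t p.1).1 p.2, a ≠ 0 := by
    intro a ha
    obtain ⟨p, hp, rfl⟩ := List.mem_map.1 ha
    obtain ⟨h, h1, h2⟩ := empiricalProcess_apply hp
    rw [h]
    positivity
  rw [one_div, Real.logb_inv, TypeProcess.prob, logb_list_prod _ _ hne, List.map_map,
    Finset.sum_list_map_count, typeEntropy, ← Fintype.sum_prod_type', ← Finset.sum_neg_distrib]
  refine (Finset.sum_subset_zero_on_sdiff (Finset.subset_univ _) ?_ ?_)
  · intro p hp
    rw [Finset.mem_sdiff, List.mem_toFinset] at hp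
    have : typeCount t p.1 p.2 = 0 := List.count_eq_zero.2 hp.2
    simp [this]
  · intro p hp
    rw [List.mem_toFinset] at hp
    obtain ⟨h, -, -⟩ := empiricalProcess_apply hp
    rw [Function.comp_apply, h, nsmul_eq_mul, ← mul_neg, ← Real.logb_inv, inv_div]
    congr 1
    rw [typeCount, Prod.mk.eta]
    congr!

end Hypersuccinct

theorem mainTheorem6 :
    ∃ c : ℝ, ∀ H : Hypersuccinct.Shape → List Bool, Hypersuccinct.IsHypersuccinctCode H →
      ∀ (k n : ℕ) (t : Hypersuccinct.Shape), t.numNodes = n → 3 ≤ n →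
        (∀ τ : Hypersuccinct.TypeProcess k, 0 < τ.prob t →
          ((H t).length : ℝ) ≤ Real.logb 2 (1 / τ.prob t) +
            c * ((n * k + n * Real.logb 2 (Real.logb 2 n)) / Real.logb 2 n)) ∧
        ((H t).length : ℝ) ≤ Hypersuccinct.typeEntropy k t +
          c * ((n * k + n * Real.logb 2 (Real.logb 2 n)) / Real.logb 2 n) := by
  refine ⟨21184, fun H hH k n t ht hn => ?_⟩
  subst ht
  refine ⟨fun τ hτ => Hypersuccinct.length_le_of_typeProcess hH k t hn τ hτ, ?_⟩
  rw [← Hypersuccinct.logb_prob_empiricalProcess]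
  exact Hypersuccinct.length_le_of_typeProcess hH k t hn _
    (Hypersuccinct.prob_empiricalProcess_pos k t)
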